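/- Let $p>3$ be a prime and let $K/\mathbb{Q}_p$ be a totally ramified finite extension with valuation ring $\mathcal{O}$. Let $E_1$ and $E_2$ be elliptic curves over $K$ with full $K$-rational $2$-torsion (that is, $E_i(K)[2]$ has four elements) and with supersingular reduction (that is, $E_i$ has good reduction and the reduced curve $\overline{E}_i$ satisfies $\overline{E}_i(\overline{k})[p]=0$, where $\overline k$ is an algebraic closure of the residue field of $\mathcal O$). Then there are $\lambda,\mu\in\mathcal{O}$ with $\lambda,\,1-\lambda,\,\mu,\,1-\mu\in\mathcal{O}^\times$ such that $E_1$ and $E_2$ are given over $K$ by the Legendre equations $y^2=x(x-1)(x-\lambda)$ and $y^2=x(x-1)(x-\mu)$ respectively, and there is a pair $$(a,b)\in\{(1,\lambda),\ (\lambda,1),\ (-1,\lambda-1),\ (\lambda-1,-1),\ (1-\lambda,-\lambda),\ (-\lambda,1-\lambda)\}$$ with $a\mu-b\neq 0$ such that the following holds for the Scholten curve $C=C_{a,b,1,\mu}$, the complete curve (in the weighted projective plane $\mathbb{P}(1,3,1)$) with affine equation $$(a\mu-b)\,Y^2=\bigl((a-b)X^2-(1-\mu)\bigr)(aX^2-1)(bX^2-\mu).$$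 1. $C$ is a smooth, geometrically irreducible curve of genus $2$ over $K$, and its equation can be written as $Y^2=u(X^2-r)(X^2-s)(X^2-t)$ with $u,r,s,t\in\mathcal{O}^\times$. 2. $C$ spans $E_1$ and $E_2$: for some $v\in\mathcal{O}^\times$ there are morphisms $\sigma_1:C\to E_1$ and $\sigma_2:C\to E_2$ defined over $K$ which, in the Legendre coordinates above, are given by $$\sigma_1(X,Y)=\bigl(u(X^2-v),\,uY\bigr),\qquad \sigma_2(X,Y)=\bigl(ust(X^2-r)X^{-2},\,-urst\,X^{-3}Y\bigr),$$ the second formula being for $X\neq 0$. 3. $C$ has a $K$-rational Weierstrass point (a point fixed by the hyperelliptic involution $(X,Y)\mapsto(X,-Y)$) of the form $W=(w,0)$ with $w\in\mathcal{O}^\times$. -/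

import Mathlib

open Polynomial

noncomputable section

namespace GenusTwoSpan

/-! ### The ring of integers of a `p`-adic field -/

section RingOfIntegers

variable (p : ℕ) [Fact p.Prime] (K : Type*) [Field K] [Algebra ℚ_[p] K] [FiniteDimensional ℚ_[p] K]

/-- The valuation ring `𝒪` of a finite extension `K` of `ℚ_p`: the closed unit ball of the unique
extension of the `p`-adic absolute value to `K`. -/
def integers : ValuationSubring K where
  carrier := {x | spectralNorm ℚ_[p] K x ≤ 1}
  mul_mem' {x y} hx hy := by
    have h := spectralMulAlgNorm_def (K := ℚ_[p]) (L := K)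
    simp only [Set.mem_ofPred_eq, ← h] at hx hy ⊢
    rw [map_mul]
    exact mul_le_one₀ hx (apply_nonneg _ _) hy
  one_mem' := by simp [spectralNorm_one]
  add_mem' {x y} hx hy :=
    (isNonarchimedean_spectralNorm (K := ℚ_[p]) (L := K) x y).trans (max_le hx hy)
  zero_mem' := by simp [spectralNorm_zero]
  neg_mem' {x} hx := by
    simpa [spectralNorm_neg (Algebra.IsAlgebraic.isAlgebraic (R := ℚ_[p]) x)] using hx
  mem_or_inv_mem' x := by
    have h := spectralMulAlgNorm_def (K := ℚ_[p]) (L := K)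
    simp only [Set.mem_ofPred_eq, ← h]
    by_cases hx : spectralMulAlgNorm ℚ_[p] K x ≤ 1
    · exact Or.inl hx
    · right
      have hx0 : x ≠ 0 := by
        rintro rfl
        exact hx (by simp)
      have h1 : spectralMulAlgNorm ℚ_[p] K x * spectralMulAlgNorm ℚ_[p] K x⁻¹ = 1 := by
        rw [← map_mul, mul_inv_cancel₀ hx0, map_one]
      have h2 : 0 ≤ spectralMulAlgNorm ℚ_[p] K x⁻¹ := apply_nonneg _ _
      nlinarith [not_le.1 hx]

/-- `𝒪` is the integral closure of `ℤ_p` in `K`. -/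
theorem mem_integers_iff (x : K) : x ∈ integers p K ↔
    ((algebraMap ℚ_[p] K).comp (algebraMap ℤ_[p] ℚ_[p])).IsIntegralElem x := by
  let _ : Algebra ℤ_[p] K := ((algebraMap ℚ_[p] K).comp (algebraMap ℤ_[p] ℚ_[p])).toAlgebra
  have : IsScalarTower ℤ_[p] ℚ_[p] K := IsScalarTower.of_algebraMap_eq fun _ => rfl
  change spectralNorm ℚ_[p] K x ≤ 1 ↔ IsIntegral ℤ_[p] x
  have hx : IsIntegral ℚ_[p] x := Algebra.IsIntegral.isIntegral x
  unfold spectralNorm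
  rw [spectralValue_le_one_iff (minpoly.monic hx)]
  constructor
  · intro h
    have hl : minpoly ℚ_[p] x ∈ lifts (algebraMap ℤ_[p] ℚ_[p]) := by
      rw [lifts_iff_coeff_lifts]
      exact fun n => ⟨⟨_, h n⟩, rfl⟩
    obtain ⟨q, hq, -, hm⟩ := lifts_and_degree_eq_and_monic hl (minpoly.monic hx)
    refine ⟨q, hm, ?_⟩
    have h0 : aeval x (q.map (algebraMap ℤ_[p] ℚ_[p])) = 0 := by rw [hq, minpoly.aeval]
    rwa [aeval_map_algebraMap] at h0
  · intro h n
    rw [minpoly.isIntegrallyClosed_eq_field_fractions' ℚ_[p] h, coeff_map]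
    exact PadicInt.norm_le_one _

instance : IsDiscreteValuationRing (integers p K) := by
  let _ : Algebra ℤ_[p] K := ((algebraMap ℚ_[p] K).comp (algebraMap ℤ_[p] ℚ_[p])).toAlgebra
  have : IsScalarTower ℤ_[p] ℚ_[p] K := IsScalarTower.of_algebraMap_eq fun _ => rfl
  have hO (x : K) : x ∈ integers p K ↔ IsIntegral ℤ_[p] x := mem_integers_iff p K x
  have : IsIntegralClosure (integers p K) ℤ_[p] K :=
    ⟨Subtype.val_injective, fun {x} => by
      rw [← hO]
      exact ⟨fun h => ⟨⟨x, h⟩, rfl⟩, by rintro ⟨y, rfl⟩; exact y.2⟩⟩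
  let _ : Algebra ℤ_[p] (integers p K) :=
    ((algebraMap ℤ_[p] K).codRestrict (integers p K).toSubring fun a =>
      (hO _).2 isIntegral_algebraMap).toAlgebra
  have : IsScalarTower ℤ_[p] (integers p K) K := IsScalarTower.of_algebraMap_eq fun _ => rfl
  have : IsDedekindDomain (integers p K) :=
    IsIntegralClosure.isDedekindDomain ℤ_[p] ℚ_[p] K (integers p K)
  have hf : ¬ IsField (integers p K) := by
    intro hK
    have hi : Algebra.IsIntegral ℤ_[p] (integers p K) :=
      IsIntegralClosure.isIntegral_algebra ℤ_[p] K
    have hinj : Function.Injective (algebraMap ℤ_[p] (integers p K)) := by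
      have h : Function.Injective (algebraMap ℤ_[p] K) :=
        (algebraMap ℚ_[p] K).injective.comp Subtype.val_injective
      intro a b hab
      apply h
      rw [IsScalarTower.algebraMap_apply ℤ_[p] (integers p K) K, hab,
        ← IsScalarTower.algebraMap_apply]
    exact IsDiscreteValuationRing.not_isField ℤ_[p] (isField_of_isIntegral_of_isField hinj hK)
  exact ((IsDiscreteValuationRing.TFAE (integers p K) hf).out 0 2).2 ‹_›

/-- `K / ℚ_p` is totally ramified: `p 𝒪 = 𝔪 ^ [K : ℚ_p]`, that is, `e = [K : ℚ_p]`. -/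
def IsTotallyRamified : Prop :=
  Ideal.span {(p : integers p K)} =
    IsLocalRing.maximalIdeal (integers p K) ^ Module.finrank ℚ_[p] K

end RingOfIntegers

/-! ### Elliptic curves -/

section EllipticCurves

open WeierstrassCurve

variable {K : Type*} [Field K]

open scoped Classical in
/-- The group `E(K)[2]` has four elements. -/
def HasFullTwoTorsion (E : WeierstrassCurve K) : Prop :=
  {P : E.toAffine.Point | 2 • P = 0}.ncard = 4

open scoped Classical in
/-- An elliptic curve over a field of characteristic `p` is supersingular if it has no nonzero
`p`-torsion point over the algebraic closure. -/
def IsSupersingular (p : ℕ) (E : WeierstrassCurve K) : Prop :=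
  ∀ P : (E.baseChange (AlgebraicClosure K)).toAffine.Point, p • P = 0 → P = 0

/-- Over the fraction field `K` of a discrete valuation ring `R` with residue characteristic `p`:
some Weierstrass equation of `E` is minimal with good reduction, and its reduction is
supersingular. -/
def HasSupersingularReduction (p : ℕ) (R : Type*) [CommRing R] [IsDomain R]
    [IsDiscreteValuationRing R] [Algebra R K] [IsFractionRing R K] (E : WeierstrassCurve K) :
    Prop :=
  ∃ (D : VariableChange K) (_ : (D • E).HasGoodReduction R),
    IsSupersingular p ((D • E).reduction R)

/-- The Legendre curve `y² = x (x - 1) (x - l)`. -/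
def legendre (l : K) : WeierstrassCurve K := ⟨0, -(1 + l), 0, l, 0⟩

/-- `v` is a triple of homogeneous coordinates `[v 0 : v 1 : v 2]` in `ℙ²` of the point `P`. -/
def IsProjCoords {L : Type*} [Field L] {E : WeierstrassCurve L} :
    E.toAffine.Point → (Fin 3 → L) → Prop
  | .zero, v => v 0 = 0 ∧ v 1 ≠ 0 ∧ v 2 = 0
  | .some x y _, v => v 2 ≠ 0 ∧ v 0 = x * v 2 ∧ v 1 = y * v 2

/-- The geometric point `P` of `E` is affine with coordinates `(x, y)` with respect to the
Weierstrass equation `D • E` of `E`; the coordinates with respect to `E` itself are then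
`(u² x + r, u³ y + u² s x + t)`, where `D = (u, r, s, t)`. -/
def HasCoords {E : WeierstrassCurve K} (D : VariableChange K) {L : Type*} [Field L] [Algebra K L]
    (P : (E.baseChange L).toAffine.Point) (x y : L) : Prop :=
  ∃ h, P = .some
    (algebraMap K L D.u ^ 2 * x + algebraMap K L D.r)
    (algebraMap K L D.u ^ 3 * y + algebraMap K L D.u ^ 2 * algebraMap K L D.s * x
      + algebraMap K L D.t) h

end EllipticCurves

/-! ### The curve `Y² = F(X)` for `F` of degree at most six

Its completion is the curve `Y² = ∑ Fᵢ Xⁱ Z⁶⁻ⁱ` in the weighted projective plane `ℙ(1, 3, 1)`. -/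

section SexticCurves

variable {K : Type*} [Field K] (F : K[X])

/-- The equation `Y² - ∑ Fᵢ Xⁱ Z⁶⁻ⁱ`, in the variables `X = X 0`, `Y = X 1`, `Z = X 2`. -/
def curveEquation : MvPolynomial (Fin 3) K :=
  MvPolynomial.X 1 ^ 2 - ∑ i ∈ Finset.range 7,
    MvPolynomial.C (F.coeff i) * MvPolynomial.X 0 ^ i * MvPolynomial.X 2 ^ (6 - i)

/-- The triple `v` is a system of weighted homogeneous coordinates of a point of the curve (the
equation excludes the point `[0 : 1 : 0]`). -/
def OnCurve {L : Type*} [Field L] [Algebra K L] (v : Fin 3 → L) : Prop :=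
  (v 0 ≠ 0 ∨ v 2 ≠ 0) ∧ MvPolynomial.aeval v (curveEquation F) = 0

/-- The affine part of the curve is `y² = F(x)`. -/
theorem onCurve_affine {L : Type*} [Field L] [Algebra K L] (hF : F.natDegree ≤ 6) (x y : L) :
    OnCurve F ![x, y, 1] ↔ y ^ 2 = aeval x F := by
  rw [aeval_eq_sum_range' (Nat.lt_succ_of_le hF)]
  simp [OnCurve, curveEquation, sub_eq_zero, Algebra.smul_def]

variable (L : Type*) [Field L] [Algebra K L]

/-- Equality in `ℙ(1, 3, 1)`: `(X, Y, Z) ∼ (c X, c³ Y, c Z)` for `c ≠ 0`. -/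
def curveSetoid : Setoid {v : Fin 3 → L // OnCurve F v} where
  r v w := ∃ c : Lˣ, w.1 = ![c * v.1 0, c ^ 3 * v.1 1, c * v.1 2]
  iseqv :=
    { refl := fun v => ⟨1, by ext i; fin_cases i <;> simp⟩
      symm := by
        rintro v w ⟨c, h⟩
        refine ⟨c⁻¹, ?_⟩
        ext i
        fin_cases i <;> simp [h]
      trans := by
        rintro v w z ⟨c, h⟩ ⟨d, h'⟩
        refine ⟨d * c, ?_⟩
        rw [h', h]
        ext i
        fin_cases i <;> simp [mul_assoc, mul_pow] }

/-- The points of the complete curve over an extension field `L` of `K`. -/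
def CurvePoint : Type _ := Quotient (curveSetoid F L)

variable {F L}

/-- The point `[v 0 : v 1 : v 2]`. -/
def CurvePoint.mk (v : Fin 3 → L) (h : OnCurve F v) : CurvePoint F L :=
  Quotient.mk (curveSetoid F L) ⟨v, h⟩

theorem OnCurve.neg {v : Fin 3 → L} (h : OnCurve F v) : OnCurve F ![v 0, -v 1, v 2] := by
  simpa [OnCurve, curveEquation] using h

/-- The hyperelliptic involution `[X : Y : Z] ↦ [X : -Y : Z]`. -/
def CurvePoint.involution : CurvePoint F L → CurvePoint F L :=
  Quotient.lift (fun v => CurvePoint.mk ![v.1 0, -v.1 1, v.1 2] v.2.neg) (by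
    rintro v w ⟨c, h⟩
    exact Quotient.sound ⟨c, by simp [h]⟩)

variable (F)

/-- The curve is smooth: the Jacobian criterion at every geometric point. -/
def IsSmooth : Prop :=
  ∀ v : Fin 3 → AlgebraicClosure K, OnCurve F v →
    ∃ i, MvPolynomial.aeval v (MvPolynomial.pderiv i (curveEquation F)) ≠ 0

/-- The curve is geometrically irreducible. -/
def IsGeometricallyIrreducible : Prop :=
  Irreducible (MvPolynomial.map (algebraMap K (AlgebraicClosure K)) (curveEquation F))

open scoped LaurentPolynomial in
/-- The coordinate ring `K[x, x⁻¹, y] / (y² - F(x))` of the open set `X Z ≠ 0`, where `x = X / Z`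
and `y = Y / Z³`. -/
abbrev OverlapRing : Type _ :=
  AdjoinRoot (X ^ 2 - C (toLaurent F) : K[T;T⁻¹][X])

/-- The coordinate ring of the chart `Z ≠ 0`, generated by `x` and `y`. -/
def chartZ : Subalgebra K (OverlapRing F) :=
  Algebra.adjoin K {AdjoinRoot.of _ (LaurentPolynomial.T 1), AdjoinRoot.root _}

/-- The coordinate ring of the chart `X ≠ 0`, generated by `x⁻¹ = Z / X` and `x⁻³ y = Y / X³`. -/
def chartX : Subalgebra K (OverlapRing F) :=
  Algebra.adjoin K {AdjoinRoot.of _ (LaurentPolynomial.T (-1)),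
    AdjoinRoot.of _ (LaurentPolynomial.T (-3)) * AdjoinRoot.root _}

/-- The genus `dim_K H¹(C, 𝒪_C)`, where the cohomology is computed by the Čech complex
`𝒪(Z ≠ 0) × 𝒪(X ≠ 0) → 𝒪(X Z ≠ 0)` of the affine open cover of the curve by two charts. -/
def genus : ℕ :=
  Module.finrank K (OverlapRing F ⧸
    (Subalgebra.toSubmodule (chartZ F) ⊔ Subalgebra.toSubmodule (chartX F)))

/-- A morphism over `K` from the complete curve to an elliptic curve `E`: a map on geometric points
which, near each point, is given in homogeneous coordinates by three weighted homogeneous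
polynomials of the same degree with coefficients in `K`. -/
structure Morphism (E : WeierstrassCurve K) where
  toFun : CurvePoint F (AlgebraicClosure K) →
    (E.baseChange (AlgebraicClosure K)).toAffine.Point
  regular : ∀ v : Fin 3 → AlgebraicClosure K, OnCurve F v →
    ∃ (d : ℕ) (A : Fin 3 → MvPolynomial (Fin 3) K),
      (∀ i, (A i).IsWeightedHomogeneous (![1, 3, 1] : Fin 3 → ℕ) d) ∧
      (∃ i, MvPolynomial.aeval v (A i) ≠ 0) ∧
      ∀ (w : Fin 3 → AlgebraicClosure K) (hw : OnCurve F w),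
        (∃ i, MvPolynomial.aeval w (A i) ≠ 0) →
          IsProjCoords (toFun (CurvePoint.mk w hw)) (fun i => MvPolynomial.aeval w (A i))

end SexticCurves

/-- The sextic `F` for which `Y² = F(X)` is the Scholten curve `C_{a,b,c,d}`, given by
`(ad - bc) Y² = ((a - b) X² - (c - d)) (a X² - c) (b X² - d)`, where `ad - bc ≠ 0`. -/
def scholtenSextic {K : Type*} [Field K] (a b c d : K) : K[X] :=
  C (a * d - b * c)⁻¹ *
    ((C (a - b) * X ^ 2 - C (c - d)) * (C a * X ^ 2 - C c) * (C b * X ^ 2 - C d))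

end GenusTwoSpan

end

/-!
The proof has an arithmetic half, which finds Legendre equations and the pair `(a, b)`, and a
geometric half, which holds for every sextic `u (X² - r) (X² - s) (X² - t)`.

*Supersingular curves over the field with `p` elements.* Let `g` be the cubic such that an elliptic
curve over a finite field is `z² = g(x)`, and `A` the coefficient of `x ^ (p - 1)` in
`g ^ ((p - 1) / 2)`. Euler's criterion and the power sums of a finite field give
`#E(𝔽_q) ≡ 1 - (coefficient of x ^ (q - 1) in g ^ ((q - 1) / 2))` modulo `p`
(`card_point_eq_one_sub_coeff`), and for `q = p ^ n` this coefficient is `A ^ n`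
(`coeff_pow_eq_hasse_pow`). If `A` were nonzero, then `p` would divide the number of points over the
extension of degree `p - 1`, and Cauchy's theorem would give a point of order `p`; so `A = 0` for a
supersingular curve (`IsSupersingular.hasse_eq_zero`). Hence `#E(𝔽_p) ≡ 1` modulo `p`, and since
this number is at most `2 p + 1` and divisible by four when the `2`-torsion is rational, it is
`p + 1` and `p ≡ 3` modulo `4` (`IsSupersingular.mod_four_eq_three`). The same criterion shows that
the Legendre parameter is not a primitive sixth root of unity
(`IsSupersingular.sq_sub_add_one_ne_zero`).

*Legendre equations and the choice of `(a, b)`.* As `K` is totally ramified, the residue field of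
`𝒪` has `p` elements. Therefore `-1` is not a square in it and every unit of `𝒪` is a square up to
sign (`isSquare_or_isSquare_neg`). The roots `e₁`, `e₂`, `e₃` of the `2`-division polynomial of a model
with good reduction are integral with unit differences, and after exchanging `e₁` and `e₂` if
necessary `e₂ - e₁` is a square, so that no quadratic twist is needed (`exists_legendre`). By a
short case distinction some pair `(a, b)` has `a μ - b` a unit and `a` a square (`exists_pair`); the
branch point `s = 1 / a` is then the square of a unit, which gives the Weierstrass point.

*Geometry.* The branch points satisfy `u (s - r) = b` and `u (t - r) = a`, which makes the two maps
land on the Legendre curves. Both extend to the complete curve by one triple of cubic forms without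
common zeros (`exists_morphism_polynomial`, `exists_morphism_laurent`). Irreducibility holds because
the sextic form has a simple factor and so is not a square, and the genus is two because `x⁻¹ y` and
`x⁻² y` represent a basis of `H¹` (`genus_eq_two`).
-/

noncomputable section

namespace GenusTwoSpan

/-! ### Counting points over finite fields modulo the characteristic -/

section PointCount

open WeierstrassCurve

theorem sum_pow_of_lt {k : Type*} [Field k] [Fintype k] {i : ℕ}
    (hi : i < 2 * (Fintype.card k - 1)) :
    ∑ x : k, x ^ i = if i = Fintype.card k - 1 then -1 else 0 := by
  classical
  have hq : 1 < Fintype.card k := Fintype.one_lt_card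
  rcases lt_trichotomy i (Fintype.card k - 1) with h | h | h
  · rw [if_neg h.ne, FiniteField.sum_pow_lt_card_sub_one k i h]
  · rw [if_pos h, h]
    have h1 (x : k) : x ^ (Fintype.card k - 1) = 1 - if x = 0 then 1 else 0 := by
      split_ifs with hx
      · rw [hx, zero_pow (by omega), sub_self]
      · rw [FiniteField.pow_card_sub_one_eq_one x hx, sub_zero]
    simp [h1]
  · rw [if_neg h.ne', ← FiniteField.sum_pow_lt_card_sub_one k (i - (Fintype.card k - 1)) (by omega)]
    refine Finset.sum_congr rfl fun x _ => ?_
    rcases eq_or_ne x 0 with rfl | hx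
    · rw [zero_pow (by omega), zero_pow (by omega)]
    · conv_lhs => rw [show i = (Fintype.card k - 1) + (i - (Fintype.card k - 1)) by omega, pow_add,
        FiniteField.pow_card_sub_one_eq_one x hx, one_mul]

theorem sum_eval_eq_neg_coeff {k : Type*} [Field k] [Fintype k] {F : k[X]}
    (hF : F.natDegree < 2 * (Fintype.card k - 1)) :
    ∑ x : k, F.eval x = -F.coeff (Fintype.card k - 1) := by
  simp_rw [eval_eq_sum_range' hF]
  rw [Finset.sum_comm]
  simp_rw [← Finset.mul_sum]
  have hq : 1 < Fintype.card k := Fintype.one_lt_card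
  rw [Finset.sum_congr rfl fun i hi => by rw [sum_pow_of_lt (Finset.mem_range.1 hi)]]
  simp only [mul_ite, mul_neg, mul_one, mul_zero, Finset.sum_ite_eq', Finset.mem_range]
  rw [if_pos (by omega)]

variable {k : Type*} [Field k]

/-- Completing the square: `Ψ₂Sq` is the cubic `4 x ^ 3 + b₂ x ^ 2 + 2 b₄ x + b₆`. -/
theorem equation_iff_sq_eq (h2 : (2 : k) ≠ 0) (W : WeierstrassCurve k) (x y : k) :
    W.toAffine.Equation x y ↔ (2 * y + (W.a₁ * x + W.a₃)) ^ 2 = W.Ψ₂Sq.eval x := by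
  rw [Affine.equation_iff]
  simp only [Ψ₂Sq, b₂, b₄, b₆, eval_add, eval_mul, eval_C, eval_pow, eval_X]
  have h4 : (4 : k) ≠ 0 := by
    rw [show (4 : k) = 2 * 2 by norm_num]
    exact mul_ne_zero h2 h2
  constructor
  · intro h
    linear_combination 4 * h
  · intro h
    apply mul_left_cancel₀ h4
    linear_combination h

theorem natCard_equation [Fintype k] [DecidableEq k] (hk : ringChar k ≠ 2)
    (W : WeierstrassCurve k) (x : k) :
    (Nat.card {y : k // W.toAffine.Equation x y} : ℤ) = quadraticChar k (W.Ψ₂Sq.eval x) + 1 := by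
  have h2 : (2 : k) ≠ 0 := Ring.two_ne_zero hk
  rw [← quadraticChar_card_sqrts hk]
  congr 1
  rw [Set.toFinset_card, ← Nat.card_eq_fintype_card]
  refine Nat.card_congr
    { toFun := fun y => ⟨2 * y.1 + (W.a₁ * x + W.a₃), (equation_iff_sq_eq h2 W x y.1).1 y.2⟩
      invFun := fun z => ⟨(z.1 - (W.a₁ * x + W.a₃)) / 2, (equation_iff_sq_eq h2 W x _).2 ?_⟩
      left_inv := fun y => ?_
      right_inv := fun z => ?_ }
  · have h : z.1 ^ 2 = W.Ψ₂Sq.eval x := z.2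
    refine Eq.trans ?_ h
    congr 1
    field_simp
    ring
  · ext
    field_simp
    ring
  · ext
    field_simp
    ring

/-- The points of an elliptic curve: `none` is the point at infinity, and the affine points are
fibred over the `x`-line. -/
def pointEquiv (W : WeierstrassCurve k) [W.IsElliptic] :
    W.toAffine.Point ≃ Option (Σ x : k, {y : k // W.toAffine.Equation x y}) where
  toFun
    | .zero => none
    | .some x y h => some ⟨x, y, h.1⟩
  invFun
    | none => .zero
    | some P => .some P.1 P.2.1 (Affine.equation_iff_nonsingular.1 P.2.2)
  left_inv P := by cases P <;> rfl
  right_inv P := by rcases P with _ | ⟨x, y, h⟩ <;> rfl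

instance [Finite k] (W : WeierstrassCurve k) [W.IsElliptic] : Finite W.toAffine.Point :=
  Finite.of_equiv _ (pointEquiv W).symm

theorem card_point [Fintype k] [DecidableEq k] (hk : ringChar k ≠ 2) (W : WeierstrassCurve k)
    [W.IsElliptic] :
    (Nat.card W.toAffine.Point : ℤ) = 1 + ∑ x : k, (quadraticChar k (W.Ψ₂Sq.eval x) + 1) := by
  rw [Nat.card_congr (pointEquiv W), Finite.card_option, Nat.card_sigma]
  push_cast
  rw [add_comm, Finset.sum_congr rfl fun x _ => natCard_equation hk W x]

theorem card_point_le [Fintype k] (hk : ringChar k ≠ 2) (W : WeierstrassCurve k) [W.IsElliptic] :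
    Nat.card W.toAffine.Point ≤ 2 * Fintype.card k + 1 := by
  classical
  have h : ∑ x : k, (quadraticChar k (W.Ψ₂Sq.eval x) + 1) ≤ ∑ _x : k, 2 :=
    Finset.sum_le_sum fun x _ => by
      rcases quadraticChar_isQuadratic k (W.Ψ₂Sq.eval x) with h | h | h <;> rw [h] <;> norm_num
  have := card_point hk W
  simp only [Finset.sum_const, Finset.card_univ, nsmul_eq_mul] at h
  omega

theorem card_point_eq_one_sub_coeff [Fintype k] (hk : ringChar k ≠ 2) (W : WeierstrassCurve k)
    [W.IsElliptic] :
    (Nat.card W.toAffine.Point : k) =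
      1 - (W.Ψ₂Sq ^ ((Fintype.card k - 1) / 2)).coeff (Fintype.card k - 1) := by
  classical
  have hodd := FiniteField.odd_card_of_char_ne_two hk
  have hq : 1 < Fintype.card k := Fintype.one_lt_card
  have hm : Fintype.card k / 2 = (Fintype.card k - 1) / 2 := by omega
  have hdeg : (W.Ψ₂Sq ^ ((Fintype.card k - 1) / 2)).natDegree < 2 * (Fintype.card k - 1) :=
    (natDegree_pow_le_of_le _ W.natDegree_Ψ₂Sq_le).trans_lt (by omega)
  have h := congrArg (Int.cast : ℤ → k) (card_point hk W)
  push_cast at h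
  rw [h, sub_eq_add_neg, ← sum_eval_eq_neg_coeff hdeg, Finset.sum_add_distrib]
  simp only [quadraticChar_eq_pow_of_char_ne_two' hk, hm, eval_pow, Finset.sum_const,
    Finset.card_univ, nsmul_eq_mul, FiniteField.cast_card_eq_zero, mul_one, add_zero]

/-- The coefficients of `x ^ (p ^ n - 1)` in `f ^ ((p ^ n - 1) / 2)` are the powers of the one for
`n = 1`, the Hasse invariant, because `f ^ p` is `f (x ^ p)` over the field with `p` elements. -/
theorem coeff_pow_eq_hasse_pow [Fintype k] (hodd : Odd (Fintype.card k)) {f : k[X]}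
    (hf : f.natDegree ≤ 3) (n : ℕ) :
    (f ^ ((Fintype.card k ^ n - 1) / 2)).coeff (Fintype.card k ^ n - 1) =
      (f ^ ((Fintype.card k - 1) / 2)).coeff (Fintype.card k - 1) ^ n := by
  set q := Fintype.card k with hq
  have hq1 : 1 < q := Fintype.one_lt_card
  induction n with
  | zero => simp
  | succ n ih =>
    have hpos : 0 < q ^ n := by positivity
    obtain ⟨a, ha⟩ : Odd (q ^ n) := hodd.pow
    obtain ⟨b, hb⟩ := hodd
    have he : (q ^ (n + 1) - 1) / 2 = (q - 1) / 2 + (q ^ n - 1) / 2 * q := by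
      rw [pow_succ, ha, hb, show (2 * a + 1) * (2 * b + 1) - 1 = 2 * (b + a * (2 * b + 1)) by
        rw [Nat.sub_eq_iff_eq_add (by nlinarith)]; ring]
      simp
    have he' : q ^ (n + 1) - 1 = (q - 1) + (q ^ n - 1) * q := by
      rw [pow_succ, ha, hb, Nat.sub_eq_iff_eq_add (by nlinarith)]
      simp
      ring
    rw [he, he', pow_add, pow_mul, ← FiniteField.expand_card, coeff_mul,
      Finset.sum_eq_single (q - 1, (q ^ n - 1) * q), ← hq, coeff_expand_mul (by omega), ih,
      pow_succ, mul_comm]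
    · rintro ⟨i, j⟩ hij hne
      rw [Finset.HasAntidiagonal.mem_antidiagonal] at hij
      dsimp only at hij ⊢
      by_cases hi : i ≤ 3 * ((q - 1) / 2)
      · rw [← hq, coeff_expand (by omega), if_neg, mul_zero]
        rintro ⟨c, rfl⟩
        apply hne
        -- `i ≡ q - 1` modulo `q` and `i < 2 q - 1` force `i = q - 1`
        have hc : c = q ^ n - 1 := by
          have h1 : (i : ℤ) + q * c = (q - 1) + (q ^ n - 1) * q := by
            have := congrArg (Nat.cast : ℕ → ℤ) hij
            push_cast [Nat.cast_sub hq1.le, Nat.cast_sub (show 1 ≤ q ^ n from hpos)] at this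
            exact this
          have h2 : (i : ℤ) < 2 * q - 1 := by omega
          have h3 : (c : ℤ) < q ^ n - 1 + 1 := by nlinarith
          have h4 : (q : ℤ) ^ n - 1 - 1 < c := by
            have : (0 : ℤ) < q := by omega
            nlinarith
          zify [show 1 ≤ q ^ n from hpos]
          omega
        subst hc
        rw [mul_comm] at hij ⊢
        rw [Nat.add_right_cancel hij]
      · rw [coeff_eq_zero_of_natDegree_lt, zero_mul]
        refine (natDegree_pow_le_of_le _ hf).trans_lt ?_
        omega
    · intro h
      exact (h (Finset.HasAntidiagonal.mem_antidiagonal.2 rfl)).elim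

end PointCount

/-! ### Supersingular curves over the prime field -/

section Supersingular

open WeierstrassCurve

/-- A supersingular elliptic curve over the field with `p` elements has Hasse invariant zero:
otherwise, by Fermat, the number of its points over the extension of degree `p - 1` is divisible by
`p`, and there is a point of order `p`. -/
theorem IsSupersingular.hasse_eq_zero {p : ℕ} [Fact p.Prime] (hp : p ≠ 2) {k : Type*} [Field k]
    [Fintype k] (hk : Fintype.card k = p) {W : WeierstrassCurve k} [W.IsElliptic]
    (hW : IsSupersingular p W) : (W.Ψ₂Sq ^ ((p - 1) / 2)).coeff (p - 1) = 0 := by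
  classical
  have hpp : p.Prime := Fact.out
  have : CharP k p := charP_of_card_eq_prime hk
  by_contra hA
  have : NeZero (p - 1) := ⟨by have := hpp.two_le; omega⟩
  let L := FiniteField.Extension k p (p - 1)
  let _ : Fintype L := Fintype.ofFinite L
  have hL : Fintype.card L = p ^ (p - 1) := by
    rw [← Nat.card_eq_fintype_card, FiniteField.natCard_extension, Nat.card_eq_fintype_card, hk]
  have : CharP L p := charP_of_injective_algebraMap (algebraMap k L).injective p
  have hchar : ringChar L ≠ 2 := by rwa [ringChar.eq L p]
  have : (W.baseChange L).IsElliptic := inferInstanceAs (W.map (algebraMap k L)).IsElliptic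
  have h1 := card_point_eq_one_sub_coeff hchar (W.baseChange L)
  have hodd : Odd (Fintype.card k) := by rw [hk]; exact hpp.odd_of_ne_two hp
  have h2 := coeff_pow_eq_hasse_pow hodd W.natDegree_Ψ₂Sq_le (p - 1)
  rw [hk] at h2
  have h3 : (W.Ψ₂Sq ^ ((p - 1) / 2)).coeff (p - 1) ^ (p - 1) = 1 := by
    rw [← hk] at hA ⊢
    exact FiniteField.pow_card_sub_one_eq_one _ hA
  rw [hL, baseChange, map_Ψ₂Sq, ← Polynomial.map_pow, coeff_map, h2, h3, map_one, sub_self,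
    CharP.cast_eq_zero_iff L p] at h1
  obtain ⟨P, hP⟩ := exists_prime_addOrderOf_dvd_card' (G := (W.baseChange L).toAffine.Point) p h1
  have hP0 : P ≠ 0 := by
    rintro rfl
    rw [addOrderOf_zero] at hP
    exact hpp.one_lt.ne hP
  let φ : L →ₐ[k] AlgebraicClosure k := IsAlgClosed.lift
  apply hP0
  apply Affine.Point.map_injective (W' := W.toAffine) φ
  rw [map_zero]
  apply hW
  have hP' : p • P = 0 := addOrderOf_dvd_iff_nsmul_eq_zero.1 hP.dvd
  rw [← map_nsmul, hP', map_zero]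

theorem four_dvd_card_of_two_torsion {G : Type*} [AddCommGroup G] {x y : G} (hx : x + x = 0)
    (hy : y + y = 0) (hx0 : x ≠ 0) (hy0 : y ≠ 0) (hxy : x ≠ y) : 4 ∣ Nat.card G := by
  have hx' : zmultiplesHom G x (2 : ℕ) = 0 := by simpa [two_zsmul] using hx
  have hy' : zmultiplesHom G y (2 : ℕ) = 0 := by simpa [two_zsmul] using hy
  let f : ZMod 2 × ZMod 2 →+ G :=
    (ZMod.lift 2 ⟨zmultiplesHom G x, hx'⟩).coprod (ZMod.lift 2 ⟨zmultiplesHom G y, hy'⟩)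
  have hf1 : ZMod.lift 2 ⟨zmultiplesHom G x, hx'⟩ 1 = x := by
    simpa using ZMod.lift_coe 2 ⟨zmultiplesHom G x, hx'⟩ 1
  have hf2 : ZMod.lift 2 ⟨zmultiplesHom G y, hy'⟩ 1 = y := by
    simpa using ZMod.lift_coe 2 ⟨zmultiplesHom G y, hy'⟩ 1
  have hxy' : x + y ≠ 0 := fun h => hxy (add_right_cancel (h.trans hy.symm))
  have hf : Function.Injective f := by
    rw [injective_iff_map_eq_zero]
    rintro ⟨a, b⟩ h
    simp only [f, AddMonoidHom.coprod_apply] at h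
    have h01 (c : ZMod 2) : c = 0 ∨ c = 1 := by revert c; decide
    rcases h01 a with rfl | rfl <;> rcases h01 b with rfl | rfl <;>
      simp_all only [map_zero, zero_add, add_zero, ne_eq, Prod.mk_zero_zero]
  have := AddSubgroup.card_dvd_of_injective f hf
  simpa using this

variable {k : Type*} [Field k]

theorem four_dvd_card_point [DecidableEq k] (h2 : (2 : k) ≠ 0) (W : WeierstrassCurve k)
    [W.IsElliptic] {e₁ e₂ : k}
    (he₁ : W.Ψ₂Sq.eval e₁ = 0) (he₂ : W.Ψ₂Sq.eval e₂ = 0) (h₁₂ : e₁ ≠ e₂) :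
    4 ∣ Nat.card W.toAffine.Point := by
  have key (e : k) (he : W.Ψ₂Sq.eval e = 0) :
      ∃ y h, Affine.Point.some e y h + Affine.Point.some e y h = (0 : W.toAffine.Point) := by
    refine ⟨-(W.a₁ * e + W.a₃) / 2, Affine.equation_iff_nonsingular.1
      ((equation_iff_sq_eq h2 W _ _).2 ?_), Affine.Point.add_self_of_Y_eq ?_⟩
    · rw [he]
      field_simp
      ring
    · rw [Affine.negY]
      field_simp
      ring
  obtain ⟨y₁, n₁, h₁⟩ := key e₁ he₁
  obtain ⟨y₂, n₂, h₂⟩ := key e₂ he₂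
  refine four_dvd_card_of_two_torsion h₁ h₂ (Affine.Point.some_ne_zero _)
    (Affine.Point.some_ne_zero _) fun h => h₁₂ ?_
  exact ((Affine.Point.some.injEq _ _ _ _ _ _).mp h).1

/-- A supersingular curve over the field with `p` elements has `p + 1` points; four divides this
number when the points of order two are rational. -/
theorem IsSupersingular.mod_four_eq_three {p : ℕ} [Fact p.Prime] (hp : p ≠ 2)
    [Fintype k] (hk : Fintype.card k = p) {W : WeierstrassCurve k} [W.IsElliptic]
    (hW : IsSupersingular p W) {e₁ e₂ : k}
    (he₁ : W.Ψ₂Sq.eval e₁ = 0) (he₂ : W.Ψ₂Sq.eval e₂ = 0) (h₁₂ : e₁ ≠ e₂) : p % 4 = 3 := by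
  classical
  have hpp : p.Prime := Fact.out
  have : CharP k p := charP_of_card_eq_prime hk
  have hchar : ringChar k ≠ 2 := by rwa [ringChar.eq k p]
  have h4 := four_dvd_card_point (Ring.two_ne_zero hchar) W he₁ he₂ h₁₂
  have hle := card_point_le hchar W
  have h1 := card_point_eq_one_sub_coeff hchar W
  rw [hk, hW.hasse_eq_zero hp hk, sub_zero] at h1
  have hpos : 0 < Nat.card W.toAffine.Point := Nat.card_pos
  rw [hk] at hle
  have h2 : ((Nat.card W.toAffine.Point - 1 : ℕ) : k) = 0 := by
    rw [Nat.cast_sub hpos, h1, Nat.cast_one, sub_self]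
  rw [CharP.cast_eq_zero_iff k p] at h2
  obtain ⟨c, hc⟩ := h2
  have hodd := hpp.odd_of_ne_two hp
  have hc2 : c ≤ 2 := by
    have : p * c ≤ p * 2 := by omega
    exact Nat.le_of_mul_le_mul_left this hpp.pos
  rw [Nat.odd_iff] at hodd
  interval_cases c <;> omega

/-- The curve of `j`-invariant zero with rational points of order two is ordinary: after a
translation `x ↦ x + c` its equation is `y ^ 2 = 4 (x ^ 3 + d)` and its Hasse invariant, up to a
nonzero factor, the binomial coefficient `choose ((p - 1) / 2) ((p - 1) / 3)`. -/
theorem IsSupersingular.sq_sub_add_one_ne_zero {p : ℕ} [Fact p.Prime] (hp : 3 < p)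
    [Fintype k] (hk : Fintype.card k = p) {W : WeierstrassCurve k} [W.IsElliptic]
    (hW : IsSupersingular p W) {e₁ e₂ e₃ : k}
    (he : W.Ψ₂Sq = C 4 * ((X - C e₁) * (X - C e₂) * (X - C e₃)))
    (h₁₂ : e₁ ≠ e₂) {l : k} (hl : e₃ - e₁ = l * (e₂ - e₁)) : l ^ 2 - l + 1 ≠ 0 := by
  intro hl0
  have hpp : p.Prime := Fact.out
  have : CharP k p := charP_of_card_eq_prime hk
  have hchar : ringChar k ≠ 2 := by rw [ringChar.eq k p]; omega
  have h2 : (2 : k) ≠ 0 := Ring.two_ne_zero hchar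
  have h3 : (3 : k) ≠ 0 := by
    intro h
    have : ((3 : ℕ) : k) = 0 := by exact_mod_cast h
    rw [CharP.cast_eq_zero_iff k p] at this
    exact absurd (Nat.le_of_dvd (by norm_num) this) (by omega)
  -- `-l` is a primitive cube root of unity, so `3 ∣ p - 1`
  have hl1 : (-l) ^ 3 = 1 := by linear_combination (-l - 1) * hl0
  have hl2 : -l ≠ 1 := by
    intro h
    apply h3
    have : l = -1 := by rw [← h, neg_neg]
    rw [this] at hl0
    linear_combination hl0
  have h3p : 3 ∣ p - 1 := by
    rw [← orderOf_eq_prime hl1 hl2, ← hk]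
    refine orderOf_dvd_of_pow_eq_one (FiniteField.pow_card_sub_one_eq_one _ ?_)
    intro h
    rw [h] at hl1
    norm_num at hl1
  obtain ⟨c, hc⟩ := h3p
  set m := (p - 1) / 2 with hm
  -- translating by the centroid `z` of the roots leaves neither a quadratic nor a linear term
  set z := (e₁ + e₂ + e₃) / 3 with hz
  set d := -((e₁ - z) * (e₂ - z) * (e₃ - z)) with hd
  have e3 : e₃ = e₁ + l * (e₂ - e₁) := by rw [← hl]; ring
  have hs : (e₁ - z) + (e₂ - z) + (e₃ - z) = 0 := by rw [hz]; field_simp; ring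
  have hp : (e₁ - z) * (e₂ - z) + (e₁ - z) * (e₃ - z) + (e₂ - z) * (e₃ - z) = 0 := by
    rw [hz, e3]
    field_simp
    linear_combination (-3 * (e₂ - e₁) ^ 2) * hl0
  have hcomp : W.Ψ₂Sq.comp (X + C z) = C 4 * (expand k 3 (X + C d)) := by
    have hs' := congrArg (C : k → k[X]) hs
    have hp' := congrArg (C : k → k[X]) hp
    rw [he, hd]
    simp only [mul_comp, sub_comp, X_comp, C_comp, map_add, expand_X, expand_C, map_neg, map_mul,
      map_sub, map_zero] at hs' hp' ⊢
    linear_combination -C 4 * X ^ 2 * hs' + C 4 * X * hp'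
  have hd0 : d ≠ 0 := by
    intro h
    have h₁ : (e₁ - z) ^ 3 = 0 := by
      linear_combination (e₁ - z) ^ 2 * hs - (e₁ - z) * hp - h + hd
    have h₂ : (e₂ - z) ^ 3 = 0 := by
      linear_combination (e₂ - z) ^ 2 * hs - (e₂ - z) * hp - h + hd
    exact h₁₂ ((sub_eq_zero.1 (pow_eq_zero_iff (by norm_num) |>.1 h₁)).trans
      (sub_eq_zero.1 (pow_eq_zero_iff (by norm_num) |>.1 h₂)).symm)
  have hA := hW.hasse_eq_zero (by omega) hk
  rw [← hm] at hA
  have hq : (m * 3) < 2 * (Fintype.card k - 1) := by omega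
  -- the sum over all `x`, hence the Hasse invariant, does not change under the translation
  have hsum : ∑ x : k, ((W.Ψ₂Sq.comp (X + C z)) ^ m).eval x = 0 := by
    rw [← neg_zero, ← hA, ← hk, ← sum_eval_eq_neg_coeff
      ((natDegree_pow_le_of_le _ W.natDegree_Ψ₂Sq_le).trans_lt (by rw [hk] at hq ⊢; exact hq))]
    simp only [eval_pow, eval_comp, eval_add, eval_X, eval_C]
    exact Fintype.sum_equiv (Equiv.addRight z) _ _ fun x => rfl
  rw [sum_eval_eq_neg_coeff, neg_eq_zero, hk, hcomp, mul_pow, ← C_pow, coeff_C_mul, ← map_pow, hc,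
    mul_comm 3 c, coeff_expand_mul (by norm_num), coeff_X_add_C_pow] at hsum
  · refine mul_ne_zero (pow_ne_zero _ ?_) (mul_ne_zero (pow_ne_zero _ hd0) ?_) hsum
    · rw [show (4 : k) = 2 * 2 by norm_num]
      exact mul_ne_zero h2 h2
    · rw [Ne, CharP.cast_eq_zero_iff k p]
      intro h
      -- `choose m c` divides `m !`, and `m < p`
      have h5 := Nat.choose_mul_factorial_mul_factorial (show c ≤ m by omega)
      have h4 := hpp.dvd_factorial.1 (h5 ▸ dvd_mul_of_dvd_left (dvd_mul_of_dvd_left h _) _)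
      omega
  · refine (natDegree_pow_le_of_le m (show _ ≤ 3 from ?_)).trans_lt hq
    rw [natDegree_comp, natDegree_X_add_C, mul_one]
    exact W.natDegree_Ψ₂Sq_le

end Supersingular

/-! ### The valuation ring of a totally ramified extension of `ℚ_p` -/

section ValuationRing

variable {p : ℕ} [Fact p.Prime] {K : Type*} [Field K] [Algebra ℚ_[p] K] [FiniteDimensional ℚ_[p] K]

/-- `𝒪` is a free `ℤ_p`-module of rank `[K : ℚ_p]`. -/
theorem natCard_quotient_span_p :
    Nat.card (integers p K ⧸ Ideal.span {(p : integers p K)}) = p ^ Module.finrank ℚ_[p] K := by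
  let _ : Algebra ℤ_[p] K := ((algebraMap ℚ_[p] K).comp (algebraMap ℤ_[p] ℚ_[p])).toAlgebra
  have : IsScalarTower ℤ_[p] ℚ_[p] K := IsScalarTower.of_algebraMap_eq fun _ => rfl
  have hO (x : K) : x ∈ integers p K ↔ IsIntegral ℤ_[p] x := mem_integers_iff p K x
  have : IsIntegralClosure (integers p K) ℤ_[p] K :=
    ⟨Subtype.val_injective, fun {x} => by
      rw [← hO]
      exact ⟨fun h => ⟨⟨x, h⟩, rfl⟩, by rintro ⟨y, rfl⟩; exact y.2⟩⟩
  let _ : Algebra ℤ_[p] (integers p K) :=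
    ((algebraMap ℤ_[p] K).codRestrict (integers p K).toSubring fun a =>
      (hO _).2 isIntegral_algebraMap).toAlgebra
  have : IsScalarTower ℤ_[p] (integers p K) K := IsScalarTower.of_algebraMap_eq fun _ => rfl
  have hinj : Function.Injective (algebraMap ℤ_[p] K) :=
    (algebraMap ℚ_[p] K).injective.comp Subtype.val_injective
  have hfaith : FaithfulSMul ℤ_[p] K := (faithfulSMul_iff_algebraMap_injective _ _).2 hinj
  have : Module.IsTorsionFree ℤ_[p] K := inferInstance
  have : Module.Free ℤ_[p] (integers p K) :=
    IsIntegralClosure.module_free ℤ_[p] ℚ_[p] K (integers p K)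
  have : Module.Finite ℤ_[p] (integers p K) :=
    IsIntegralClosure.finite ℤ_[p] ℚ_[p] K (integers p K)
  have hrank : Module.finrank ℤ_[p] (integers p K) = Module.finrank ℚ_[p] K :=
    IsIntegralClosure.rank ℤ_[p] ℚ_[p] K (integers p K)
  have hspan : Ideal.span {(p : integers p K)} =
      (IsLocalRing.maximalIdeal ℤ_[p]).map (algebraMap ℤ_[p] (integers p K)) := by
    rw [PadicInt.maximalIdeal_eq_span_p, Ideal.map_span, Set.image_singleton, map_natCast]
  have hcard : Nat.card (ℤ_[p] ⧸ IsLocalRing.maximalIdeal ℤ_[p]) = p := by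
    exact (Nat.card_congr PadicInt.residueField.toEquiv).trans (Nat.card_zmod p)
  let _ := Ideal.Quotient.field (IsLocalRing.maximalIdeal ℤ_[p])
  rw [hspan, Module.natCard_eq_pow_finrank (K := ℤ_[p] ⧸ IsLocalRing.maximalIdeal ℤ_[p]), hcard]
  congr 1
  rw [← hrank]
  exact IsLocalRing.finrank_quotient_map ..

/-- Both `𝒪 / p 𝒪` and `𝒪 / 𝔪 ^ n` are counted, for `n = [K : ℚ_p]`. -/
theorem IsTotallyRamified.natCard_residueField (hK : IsTotallyRamified p K) :
    Nat.card (IsLocalRing.ResidueField (integers p K)) = p := by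
  have h := natCard_quotient_span_p (p := p) (K := K)
  rw [hK] at h
  have h1 := cardQuot_pow_of_prime (IsDiscreteValuationRing.not_a_field (integers p K))
    (i := Module.finrank ℚ_[p] K)
  rw [Submodule.cardQuot_apply, Submodule.cardQuot_apply] at h1
  exact Nat.pow_left_injective Module.finrank_pos.ne' (h1.symm.trans h)

theorem isUnit_iff_spectralNorm_eq_one (x : integers p K) :
    IsUnit x ↔ spectralNorm ℚ_[p] K x = 1 := by
  rcases eq_or_ne (x : K) 0 with hx | hx
  · rw [hx, spectralNorm_zero]
    simp [show x = 0 from Subtype.ext hx]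
  have h := spectralMulAlgNorm_def (K := ℚ_[p]) (L := K)
  have h1 : spectralNorm ℚ_[p] K x * spectralNorm ℚ_[p] K (x : K)⁻¹ = 1 := by
    rw [← h, ← h, ← map_mul, mul_inv_cancel₀ hx, map_one]
  have hx1 : spectralNorm ℚ_[p] K x ≤ 1 := x.2
  constructor
  · rintro ⟨u, rfl⟩
    have h2 : spectralNorm ℚ_[p] K ((u⁻¹ : (integers p K)ˣ) : integers p K) ≤ 1 :=
      ((u⁻¹ : (integers p K)ˣ) : integers p K).2
    rw [show (((u⁻¹ : (integers p K)ˣ) : integers p K) : K) = ((u : integers p K) : K)⁻¹ by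
      exact eq_inv_of_mul_eq_one_left <| congrArg Subtype.val u.inv_mul] at h2
    nlinarith [spectralNorm_nonneg (K := ℚ_[p]) ((u : integers p K) : K)]
  · intro h2
    rw [h2, one_mul] at h1
    exact IsUnit.of_mul_eq_one ⟨(x : K)⁻¹, h1.le⟩ (Subtype.ext (mul_inv_cancel₀ hx))

/-- A unit which is a square modulo the maximal ideal is a square (a case of Hensel's lemma). If a
square root `α` of `a` were not in `K`, the conjugates `α - b` and `-α - b`, whose product is
`b ^ 2 - a`, would have equal absolute value less than one, and so would their sum `-2 b`. -/
theorem isSquare_of_isSquare_residue (h2 : IsUnit (2 : integers p K)) {a b : integers p K}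
    (hb : IsUnit b) (hab : ¬ IsUnit (b ^ 2 - a)) : IsSquare a := by
  obtain ⟨α, hα⟩ := IsAlgClosed.exists_pow_nat_eq (algebraMap K (AlgebraicClosure K) a)
    (n := 2) (by norm_num)
  by_cases hK : α ∈ (algebraMap K (AlgebraicClosure K)).range
  · obtain ⟨c, rfl⟩ := hK
    rw [← map_pow] at hα
    have hc : c ^ 2 = a := (algebraMap K (AlgebraicClosure K)).injective hα
    have hcO : c ∈ integers p K :=
      (mem_integers_iff p K c).2 (by
        let _ : Algebra ℤ_[p] K := ((algebraMap ℚ_[p] K).comp (algebraMap ℤ_[p] ℚ_[p])).toAlgebra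
        have h : IsIntegral ℤ_[p] (c ^ 2) := by
          rw [hc]
          exact (mem_integers_iff p K a).1 a.2
        exact h.of_pow (by norm_num))
    exact ⟨⟨c, hcO⟩, Subtype.ext (by rw [← hc, pow_two]; rfl)⟩
  exfalso
  have hmin (β : AlgebraicClosure K) (hβ : β ^ 2 = algebraMap K (AlgebraicClosure K) a)
      (hβK : β ∉ (algebraMap K (AlgebraicClosure K)).range) :
      minpoly K β = X ^ 2 - C (a : K) := by
    have hi : IsIntegral K β := Algebra.IsIntegral.isIntegral β
    have hroot : aeval β (X ^ 2 - C (a : K)) = 0 := by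
      rw [map_sub, map_pow, aeval_X, aeval_C, hβ, sub_self]
    symm
    refine eq_of_monic_of_dvd_of_natDegree_le (minpoly.monic hi)
      (monic_X_pow_sub_C (a : K) two_ne_zero) (minpoly.dvd K β hroot) ?_
    rw [natDegree_X_pow_sub_C]
    exact (minpoly.two_le_natDegree_iff hi).2 hβK
  have hconj : IsConjRoot K α (-α) := by
    rw [IsConjRoot, hmin α hα hK, hmin (-α) (by rw [neg_sq, hα]) (by rwa [neg_mem_iff])]
  obtain ⟨σ, hσ⟩ := isConjRoot_iff_exists_algEquiv.1 hconj
  set N := spectralMulAlgNorm ℚ_[p] (AlgebraicClosure K) with hN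
  have hNdef (x : AlgebraicClosure K) : N x = spectralNorm ℚ_[p] (AlgebraicClosure K) x :=
    spectralMulAlgNorm_def x
  have hNK (x : K) : N (algebraMap K _ x) = spectralNorm ℚ_[p] K x := by
    rw [hNdef, ← spectralNorm.eq_of_tower]
  set β := algebraMap K (AlgebraicClosure K) b with hβ
  have h1 : N (α - β) = N (-α - β) := by
    rw [hNdef, hNdef, spectralNorm_eq_of_equiv (σ.restrictScalars ℚ_[p]) (-α - β)]
    congr 1
    simp [hσ, hβ]
  have h3 : N (α - β) * N (-α - β) < 1 := by
    rw [← map_mul, show (α - β) * (-α - β) = algebraMap K _ ((b ^ 2 - a : integers p K) : K) by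
      change _ = algebraMap K (AlgebraicClosure K) ((b : K) ^ 2 - a)
      rw [map_sub, map_pow, ← hα]
      ring, hNK]
    rw [isUnit_iff_spectralNorm_eq_one] at hab
    exact lt_of_le_of_ne (b ^ 2 - a).2 hab
  have h4 : N (α - β) < 1 := by
    rw [← h1] at h3
    nlinarith [apply_nonneg N (α - β)]
  have h5 : N ((α - β) + (-α - β)) < 1 :=
    (isNonarchimedean_spectralNorm (K := ℚ_[p]) (L := AlgebraicClosure K) _ _).trans_lt
      (max_lt h4 (h1.symm.trans_lt h4))
  rw [show (α - β) + (-α - β) = algebraMap K _ ((-(2 * b) : integers p K) : K) by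
    change _ = algebraMap K (AlgebraicClosure K) (-(2 * (b : K)))
    rw [map_neg, map_mul, map_ofNat]
    ring, hNK, (isUnit_iff_spectralNorm_eq_one _).1 (h2.mul hb).neg] at h5
  exact lt_irrefl _ h5

theorem isUnit_natCast_of_lt (hK : IsTotallyRamified p K) {n : ℕ} (h0 : 0 < n) (hn : n < p) :
    IsUnit (n : integers p K) := by
  have hk := hK.natCard_residueField
  let _ : Fintype (IsLocalRing.ResidueField (integers p K)) :=
    have := Nat.finite_of_card_ne_zero (hk.trans_ne (Fact.out : p.Prime).ne_zero)
    Fintype.ofFinite _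
  rw [Nat.card_eq_fintype_card] at hk
  have : CharP (IsLocalRing.ResidueField (integers p K)) p := charP_of_card_eq_prime hk
  rw [← IsLocalRing.residue_ne_zero_iff_isUnit, map_natCast, Ne,
    CharP.cast_eq_zero_iff (IsLocalRing.ResidueField (integers p K)) p]
  exact fun h => absurd (Nat.le_of_dvd h0 h) (by omega)

/-- Over a residue field with `p ≡ 3` modulo `4` elements, `-1` is not a square, so every unit is a
square up to sign. -/
theorem isSquare_or_isSquare_neg (hK : IsTotallyRamified p K) (h4 : p % 4 = 3)
    {x : integers p K} (hx : IsUnit x) : IsSquare x ∨ IsSquare (-x) := by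
  classical
  have hk := hK.natCard_residueField
  let _ : Fintype (IsLocalRing.ResidueField (integers p K)) :=
    have := Nat.finite_of_card_ne_zero (hk.trans_ne (Fact.out : p.Prime).ne_zero)
    Fintype.ofFinite _
  rw [Nat.card_eq_fintype_card] at hk
  have h2 : IsUnit (2 : integers p K) := isUnit_natCast_of_lt hK (n := 2) (by norm_num) (by omega)
  have lift (y : integers p K) (hy : IsUnit y) (h : IsSquare (IsLocalRing.residue _ y)) :
      IsSquare y := by
    obtain ⟨c, hc⟩ := h
    obtain ⟨b, rfl⟩ := IsLocalRing.residue_surjective c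
    have hy0 := IsLocalRing.residue_ne_zero_iff_isUnit y |>.2 hy
    refine isSquare_of_isSquare_residue h2 (b := b) ?_ ?_
    · rw [← IsLocalRing.residue_ne_zero_iff_isUnit]
      intro h
      rw [hc, h, mul_zero] at hy0
      exact hy0 rfl
    · rw [← IsLocalRing.residue_ne_zero_iff_isUnit, not_not, map_sub, map_pow, hc, pow_two,
        sub_self]
  have hx0 := IsLocalRing.residue_ne_zero_iff_isUnit x |>.2 hx
  by_cases h : IsSquare (IsLocalRing.residue _ x)
  · exact Or.inl (lift x hx h)
  · refine Or.inr (lift (-x) hx.neg ?_)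
    have hm1 : ¬ IsSquare (-1 : IsLocalRing.ResidueField (integers p K)) := by
      rw [FiniteField.isSquare_neg_one_iff, hk]
      omega
    rw [← quadraticChar_neg_one_iff_not_isSquare] at h hm1
    rw [map_neg, ← quadraticChar_one_iff_isSquare (neg_ne_zero.2 hx0), neg_eq_neg_one_mul, map_mul,
      h, hm1]
    norm_num

/-- `-1` is not a square modulo `𝔪`. -/
theorem isUnit_sq_add_one (hK : IsTotallyRamified p K) (h4 : p % 4 = 3) (x : integers p K) :
    IsUnit (x ^ 2 + 1) := by
  have hk := hK.natCard_residueField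
  let _ : Fintype (IsLocalRing.ResidueField (integers p K)) :=
    have := Nat.finite_of_card_ne_zero (hk.trans_ne (Fact.out : p.Prime).ne_zero)
    Fintype.ofFinite _
  rw [Nat.card_eq_fintype_card] at hk
  have hm1 : ¬ IsSquare (-1 : IsLocalRing.ResidueField (integers p K)) := by
    rw [FiniteField.isSquare_neg_one_iff, hk]
    omega
  rw [← IsLocalRing.residue_ne_zero_iff_isUnit, map_add, map_pow, map_one]
  intro h
  exact hm1 ⟨IsLocalRing.residue _ x, by linear_combination -h⟩

end ValuationRing

/-! ### Legendre equations -/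

section Legendre

open WeierstrassCurve

section Field

variable {K : Type*} [Field K]

/-- The points of order two are those with `2 y + a₁ x + a₃ = 0`, so they have distinct `x`, which are
roots of the `2`-division polynomial. -/
theorem exists_roots_of_hasFullTwoTorsion (h2 : (2 : K) ≠ 0) {E : WeierstrassCurve K}
    (h : HasFullTwoTorsion E) :
    ∃ x : Fin 3 → K, Function.Injective x ∧ ∀ i, E.Ψ₂Sq.eval (x i) = 0 := by
  classical
  have key (P : E.toAffine.Point) (hP : 2 • P = 0) (hP0 : P ≠ 0) :
      ∃ x y h, P = .some x y h ∧ 2 * y + (E.a₁ * x + E.a₃) = 0 := by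
    match P with
    | .zero => exact absurd rfl hP0
    | .some x y h =>
      refine ⟨x, y, h, rfl, ?_⟩
      rw [two_nsmul, ← eq_neg_iff_add_eq_zero, Affine.Point.neg_some] at hP
      have hy := ((Affine.Point.some.injEq _ _ _ _ _ _).mp hP).2
      rw [Affine.negY] at hy
      linear_combination hy
  have hncard : ({P : E.toAffine.Point | 2 • P = 0} \ {0}).ncard = 3 := by
    have h4 : {P : E.toAffine.Point | 2 • P = 0}.ncard = 4 := by
      unfold HasFullTwoTorsion at h
      convert h
    have := Set.ncard_sdiff_singleton_add_one (a := (0 : E.toAffine.Point))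
      (s := {P : E.toAffine.Point | 2 • P = 0}) (smul_zero 2)
      (Set.finite_of_ncard_ne_zero (by omega))
    omega
  have hfin := Set.finite_of_ncard_ne_zero (hncard.trans_ne (by norm_num))
  have : Finite ↥({P : E.toAffine.Point | 2 • P = 0} \ {0}) := hfin
  let e := (Finite.equivFinOfCardEq hncard).symm
  choose x y hn hxy heq using fun i => key (e i).1 (e i).2.1 (e i).2.2
  refine ⟨x, fun i j hij => ?_, fun i => ?_⟩
  · have hy : y i = y j := by
      apply mul_left_cancel₀ h2
      have hi := heq i
      rw [hij] at hi
      linear_combination hi - heq j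
    apply e.injective
    apply Subtype.ext
    rw [hxy i, hxy j, Affine.Point.some.injEq]
    exact ⟨hij, hy⟩
  · rw [← (equation_iff_sq_eq h2 E (x i) (y i)).1 (hn i).1, heq i]
    ring

theorem Ψ₂Sq_eval_variableChange (E : WeierstrassCurve K) (D : VariableChange K) (x : K) :
    (D • E).Ψ₂Sq.eval ((x - D.r) / D.u ^ 2) = E.Ψ₂Sq.eval x / D.u ^ 6 := by
  simp only [Ψ₂Sq, eval_add, eval_mul, eval_C, eval_pow, eval_X, variableChange_b₂,
    variableChange_b₄, variableChange_b₆, Units.val_inv_eq_inv_val]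
  have := D.u.ne_zero
  field_simp
  ring

end Field

theorem Ψ₂Sq_eq_prod {R : Type*} [CommRing R] [IsDomain R] (W : WeierstrassCurve R)
    {x : Fin 3 → R} (hx : Function.Injective x) (h : ∀ i, W.Ψ₂Sq.eval (x i) = 0) :
    W.Ψ₂Sq = C 4 * ((X - C (x 0)) * (X - C (x 1)) * (X - C (x 2))) := by
  rw [← sub_eq_zero]
  refine eq_zero_of_natDegree_lt_card_of_eval_eq_zero _ hx (fun i => ?_) ?_
  · rw [eval_sub, h]
    fin_cases i <;> simp
  · rw [show W.Ψ₂Sq - C 4 * ((X - C (x 0)) * (X - C (x 1)) * (X - C (x 2))) =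
      C (W.b₂ + 4 * (x 0 + x 1 + x 2)) * X ^ 2 +
      C (2 * W.b₄ - 4 * (x 0 * x 1 + x 0 * x 2 + x 1 * x 2)) * X +
      C (W.b₆ + 4 * (x 0 * x 1 * x 2)) by
        simp only [Ψ₂Sq, map_add, map_mul, map_sub]
        ring]
    exact natDegree_quadratic_le.trans_lt (by simp)

theorem map_Ψ₂Sq_eq_prod {R S : Type*} [CommRing R] [CommRing S] {W : WeierstrassCurve R}
    {x₀ x₁ x₂ : R} (h : W.Ψ₂Sq = C 4 * ((X - C x₀) * (X - C x₁) * (X - C x₂))) (f : R →+* S) :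
    (W.map f).Ψ₂Sq = C 4 * ((X - C (f x₀)) * (X - C (f x₁)) * (X - C (f x₂))) := by
  rw [map_Ψ₂Sq, h]
  simp only [Polynomial.map_mul, Polynomial.map_sub, map_X, map_C]
  rw [map_ofNat f 4]

theorem b_eq_of_Ψ₂Sq_eq_prod {R : Type*} [CommRing R] {W : WeierstrassCurve R} {x₀ x₁ x₂ : R}
    (h : W.Ψ₂Sq = C 4 * ((X - C x₀) * (X - C x₁) * (X - C x₂))) :
    W.b₂ = -4 * (x₀ + x₁ + x₂) ∧ 2 * W.b₄ = 4 * (x₀ * x₁ + x₀ * x₂ + x₁ * x₂) ∧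
      W.b₆ = -4 * (x₀ * x₁ * x₂) := by
  have h' : C 4 * ((X - C x₀) * (X - C x₁) * (X - C x₂)) = C 4 * X ^ 3 +
      C (-4 * (x₀ + x₁ + x₂)) * X ^ 2 + C (4 * (x₀ * x₁ + x₀ * x₂ + x₁ * x₂)) * X +
      C (-4 * (x₀ * x₁ * x₂)) := by
    simp only [map_add, map_mul, map_neg]
    ring
  rw [h', Ψ₂Sq] at h
  refine ⟨?_, ?_, ?_⟩
  · have := congrArg (fun P => coeff P 2) h
    simp only [coeff_add, coeff_C_mul, coeff_X_pow, coeff_X, coeff_C] at this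
    norm_num at this
    linear_combination this
  · have := congrArg (fun P => coeff P 1) h
    simp only [coeff_add, coeff_C_mul, coeff_X_pow, coeff_X, coeff_C] at this
    norm_num at this
    linear_combination this
  · have := congrArg (fun P => coeff P 0) h
    simp only [coeff_add, coeff_C_mul, coeff_X_pow, coeff_X, coeff_C] at this
    norm_num at this
    linear_combination this

theorem Δ_eq_of_Ψ₂Sq_eq_prod {R : Type*} [CommRing R] {W : WeierstrassCurve R} {x₀ x₁ x₂ : R}
    (h : W.Ψ₂Sq = C 4 * ((X - C x₀) * (X - C x₁) * (X - C x₂))) :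
    16 * W.Δ = 256 * ((x₁ - x₀) * (x₂ - x₀) * (x₂ - x₁)) ^ 2 := by
  obtain ⟨h2, h4, h6⟩ := b_eq_of_Ψ₂Sq_eq_prod h
  rw [← twoTorsionPolynomial_discr, twoTorsionPolynomial, Cubic.discr]
  dsimp only
  rw [h2, h4, h6]
  ring

/-- The roots of the `2`-division polynomial of an integral equation are integral, since its leading
coefficient `4` is a unit. -/
theorem exists_algebraMap_eq_of_Ψ₂Sq_eval_eq_zero {R K : Type*} [CommRing R] [IsDomain R]
    [IsIntegrallyClosed R] [Field K] [Algebra R K] [IsFractionRing R K] (h2 : IsUnit (2 : R))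
    (W : WeierstrassCurve R) {x : K}
    (hx : (W.baseChange K).Ψ₂Sq.eval x = 0) : ∃ y : R, algebraMap R K y = x := by
  have h4 : IsUnit (4 : R) := by
    rw [show (4 : R) = 2 * 2 by norm_num]
    exact h2.mul h2
  have hint : IsIntegral R (algebraMap R K 4 * x) := by
    refine ⟨X ^ 3 + C W.b₂ * X ^ 2 + C (8 * W.b₄) * X + C (16 * W.b₆), by monicity!, ?_⟩
    simp only [Ψ₂Sq, baseChange, map_b₂, map_b₄, map_b₆, eval_add, eval_mul, eval_C, eval_pow,
      eval_X] at hx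
    simp only [eval₂_add, eval₂_mul, eval₂_C, eval₂_pow, eval₂_X]
    simp only [map_mul, map_ofNat]
    linear_combination 16 * hx
  obtain ⟨z, hz⟩ := IsIntegrallyClosed.isIntegral_iff.1 hint
  obtain ⟨u, hu⟩ := h4
  refine ⟨↑u⁻¹ * z, ?_⟩
  rw [map_mul, hz, ← hu, ← mul_assoc, ← map_mul, Units.inv_mul, map_one, one_mul]

/-- `x = c ^ 2 x' + x₀` moves `x₀`, `x₁`, `x₂` to `0`, `1`, `l`. -/
theorem exists_variableChange_eq_legendre {K : Type*} [Field K] (h2 : (2 : K) ≠ 0)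
    {W : WeierstrassCurve K} {x₀ x₁ x₂ c l : K}
    (h : W.Ψ₂Sq = C 4 * ((X - C x₀) * (X - C x₁) * (X - C x₂))) (hc0 : c ≠ 0)
    (hc : x₁ - x₀ = c ^ 2) (hl : x₂ - x₀ = l * (x₁ - x₀)) :
    ∃ D : VariableChange K, D • W = legendre l := by
  obtain ⟨e2, e4, e6⟩ := b_eq_of_Ψ₂Sq_eq_prod h
  have h4 : (4 : K) ≠ 0 := by
    rw [show (4 : K) = 2 * 2 by norm_num]
    exact mul_ne_zero h2 h2
  simp only [b₂, b₄, b₆] at e2 e4 e6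
  have hx1 : x₁ = x₀ + c ^ 2 := by rw [← hc]; ring
  have hx2 : x₂ = x₀ + l * c ^ 2 := by rw [← hc, ← hl]; ring
  subst hx1 hx2
  have e4' := mul_left_cancel₀ h2 (e4.trans (show _ = 2 * (2 * (x₀ * (x₀ + c ^ 2) +
    x₀ * (x₀ + l * c ^ 2) + (x₀ + c ^ 2) * (x₀ + l * c ^ 2))) by ring))
  refine ⟨⟨Units.mk0 c hc0, x₀, -W.a₁ / 2, -(W.a₁ * x₀ + W.a₃) / 2⟩, ?_⟩
  ext
  · rw [variableChange_a₁]
    simp only [legendre, Units.val_inv_eq_inv_val, Units.val_mk0]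
    field_simp
    ring
  · rw [variableChange_a₂]
    simp only [legendre, Units.val_inv_eq_inv_val, Units.val_mk0]
    apply mul_left_cancel₀ h4
    field_simp
    linear_combination e2
  · rw [variableChange_a₃]
    simp only [legendre, Units.val_inv_eq_inv_val, Units.val_mk0]
    field_simp
    ring
  · rw [variableChange_a₄]
    simp only [legendre, Units.val_inv_eq_inv_val, Units.val_mk0]
    apply mul_left_cancel₀ h4
    field_simp
    linear_combination x₀ * e2 + e4'
  · rw [variableChange_a₆]
    simp only [legendre, Units.val_inv_eq_inv_val, Units.val_mk0]
    apply mul_left_cancel₀ h4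
    field_simp
    linear_combination x₀ ^ 2 * e2 + x₀ * e4 + e6

variable {p : ℕ} [Fact p.Prime] {K : Type*} [Field K] [Algebra ℚ_[p] K] [FiniteDimensional ℚ_[p] K]

/-- Supersingular reduction forces `p ≡ 3` modulo `4`, so one of
the two orderings of a pair of points of order two gives a Legendre equation without a quadratic
twist; its parameter is not a primitive sixth root of unity modulo `𝔪`. -/
theorem exists_legendre (hp : 3 < p) (hK : IsTotallyRamified p K) {E : WeierstrassCurve K}
    (h : HasFullTwoTorsion E) (hs : HasSupersingularReduction p (integers p K) E) :
    p % 4 = 3 ∧ ∃ (l : integers p K) (D : VariableChange K), IsUnit l ∧ IsUnit (1 - l) ∧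
      IsUnit (l ^ 2 - l + 1) ∧ D • E = legendre (l : K) := by
  have h2 : IsUnit (2 : integers p K) := isUnit_natCast_of_lt hK (n := 2) (by norm_num) (by omega)
  have h2K : (2 : K) ≠ 0 := by
    intro h
    have : (2 : integers p K) = 0 := Subtype.ext h
    exact h2.ne_zero this
  obtain ⟨x, hxinj, hx⟩ := exists_roots_of_hasFullTwoTorsion h2K h
  obtain ⟨D₀, hgood, hss⟩ := hs
  set W := D₀ • E with hW
  have hell := (hasGoodReduction_iff_isElliptic_reduction (integers p K)).1 hgood
  set I := W.integralModel (integers p K) with hI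
  have hIW : I.baseChange K = W := baseChange_integralModel_eq _ _
  have hIr : W.reduction (integers p K) = I.map (IsLocalRing.residue (integers p K)) := rfl
  have hroot (i : Fin 3) : ∃ y : integers p K, algebraMap _ K y = (x i - D₀.r) / D₀.u ^ 2 := by
    refine exists_algebraMap_eq_of_Ψ₂Sq_eval_eq_zero h2 I ?_
    rw [hIW, hW, Ψ₂Sq_eval_variableChange, hx, zero_div]
  choose e he using hroot
  have heinj : Function.Injective e := by
    intro i j hij
    have := he i
    rw [hij, he j] at this
    have hu := D₀.u.ne_zero
    field_simp at this
    exact hxinj (by linear_combination -this)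
  have hI0 (i : Fin 3) : I.Ψ₂Sq.eval (e i) = 0 := by
    apply FaithfulSMul.algebraMap_injective (integers p K) K
    rw [← eval₂_at_apply, ← eval_map, ← map_Ψ₂Sq, he, map_zero]
    change (I.baseChange K).Ψ₂Sq.eval _ = 0
    rw [hIW, hW, Ψ₂Sq_eval_variableChange, hx, zero_div]
  have hprod := Ψ₂Sq_eq_prod I heinj hI0
  have hΔ : IsUnit I.Δ := by
    rw [← IsLocalRing.residue_ne_zero_iff_isUnit, ← map_Δ]
    exact hell.isUnit.ne_zero
  have hdiff : IsUnit ((e 1 - e 0) * (e 2 - e 0) * (e 2 - e 1)) := by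
    have h16 : IsUnit (16 * I.Δ) := by
      rw [show (16 : integers p K) = 2 ^ 4 by norm_num]
      exact (h2.pow 4).mul hΔ
    rw [Δ_eq_of_Ψ₂Sq_eq_prod hprod] at h16
    exact (isUnit_pow_iff two_ne_zero).1 (isUnit_of_mul_isUnit_right h16)
  have h10 : IsUnit (e 1 - e 0) := isUnit_of_mul_isUnit_left (isUnit_of_mul_isUnit_left hdiff)
  have h20 : IsUnit (e 2 - e 0) := isUnit_of_mul_isUnit_right (isUnit_of_mul_isUnit_left hdiff)
  have h21 : IsUnit (e 2 - e 1) := isUnit_of_mul_isUnit_right hdiff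
  have hk := hK.natCard_residueField
  let _ : Fintype (IsLocalRing.ResidueField (integers p K)) :=
    have := Nat.finite_of_card_ne_zero (hk.trans_ne (Fact.out : p.Prime).ne_zero)
    Fintype.ofFinite _
  rw [Nat.card_eq_fintype_card] at hk
  have hres (y : integers p K) (hy : I.Ψ₂Sq.eval y = 0) :
      (W.reduction (integers p K)).Ψ₂Sq.eval (IsLocalRing.residue _ y) = 0 := by
    rw [hIr, map_Ψ₂Sq, eval_map, eval₂_at_apply, hy, map_zero]
  have hne {y z : integers p K} (hyz : IsUnit (z - y)) :
      IsLocalRing.residue _ y ≠ IsLocalRing.residue _ z := by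
    rw [← IsLocalRing.residue_ne_zero_iff_isUnit, map_sub, sub_ne_zero] at hyz
    exact hyz.symm
  have h4 : p % 4 = 3 :=
    hss.mod_four_eq_three (by omega) hk (hres _ (hI0 0)) (hres _ (hI0 1)) (hne h10)
  refine ⟨h4, ?_⟩
  -- it suffices to treat an ordering of the roots with `y₁ - y₀` a square
  suffices key : ∀ y₀ y₁ y₂ : integers p K, IsUnit (y₁ - y₀) → IsUnit (y₂ - y₀) →
      IsUnit (y₂ - y₁) → I.Ψ₂Sq = C 4 * ((X - C y₀) * (X - C y₁) * (X - C y₂)) →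
      IsSquare (y₁ - y₀) → ∃ (l : integers p K) (D : VariableChange K), IsUnit l ∧ IsUnit (1 - l) ∧
      IsUnit (l ^ 2 - l + 1) ∧ D • E = legendre (l : K) by
    rcases isSquare_or_isSquare_neg hK h4 h10 with h | h
    · exact key _ _ _ h10 h20 h21 hprod h
    · refine key (e 1) (e 0) (e 2) ?_ h21 h20 (hprod.trans (by ring)) (by rwa [neg_sub] at h)
      simpa using h10.neg
  intro y₀ y₁ y₂ h10 h20 h21 hprod hsq
  obtain ⟨c, hc⟩ := hsq
  obtain ⟨d, hd⟩ := h10.exists_right_inv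
  have hl : y₂ - y₀ = (d * (y₂ - y₀)) * (y₁ - y₀) := by linear_combination -(y₂ - y₀) * hd
  have hd' : IsUnit d := IsUnit.of_mul_eq_one _ ((mul_comm _ _).trans hd)
  obtain ⟨D, hD⟩ := exists_variableChange_eq_legendre (W := W) (x₀ := (y₀ : K)) (x₁ := y₁)
    (x₂ := y₂) (c := c) (l := ((d * (y₂ - y₀) : integers p K) : K)) h2K
    (by
      rw [← hIW]
      exact map_Ψ₂Sq_eq_prod hprod (algebraMap (integers p K) K))
    (by
      intro h0
      have : c = 0 := Subtype.ext h0
      rw [this, mul_zero] at hc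
      exact h10.ne_zero hc)
    (by rw [pow_two]; exact congrArg Subtype.val hc) (congrArg Subtype.val hl)
  refine ⟨d * (y₂ - y₀), D * D₀, hd'.mul h20, ?_, ?_, by rw [mul_smul, ← hW, hD]⟩
  · rw [show 1 - d * (y₂ - y₀) = d * (-(y₂ - y₁)) by linear_combination -hd]
    exact hd'.mul h21.neg
  · rw [← IsLocalRing.residue_ne_zero_iff_isUnit, map_add, map_sub, map_pow, map_one]
    refine hss.sq_sub_add_one_ne_zero hp hk (e₁ := IsLocalRing.residue _ y₀)
      (e₂ := IsLocalRing.residue _ y₁) (e₃ := IsLocalRing.residue _ y₂) ?_ (hne h10) ?_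
    · exact map_Ψ₂Sq_eq_prod hprod _
    · rw [← map_sub, ← map_sub, ← map_mul, ← hl]

end Legendre

/-! ### The genus of `Y ^ 2 = F(X)` -/

section Genus

open scoped LaurentPolynomial
open LaurentPolynomial (T)

variable {K : Type*} [Field K] (F : K[X])

theorem monic_overlap : (X ^ 2 - C (toLaurent F) : K[T;T⁻¹][X]).Monic :=
  monic_X_pow_sub_C _ two_ne_zero

variable {F}

theorem root_sq : (AdjoinRoot.root _ : OverlapRing F) ^ 2 = AdjoinRoot.of _ (toLaurent F) := by
  have := AdjoinRoot.eval₂_root (X ^ 2 - C (toLaurent F) : K[T;T⁻¹][X])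
  rwa [eval₂_sub, eval₂_pow, eval₂_X, eval₂_C, sub_eq_zero] at this

variable (F) in
/-- The coefficient `b` of an element `a + b y` of the coordinate ring `K[x, x⁻¹, y]`. -/
def yCoeff : OverlapRing F →ₗ[K] K[T;T⁻¹] :=
  ((lcoeff K[T;T⁻¹] 1).comp (AdjoinRoot.modByMonicHom (monic_overlap F))).restrictScalars K

theorem degree_overlap : (X ^ 2 - C (toLaurent F) : K[T;T⁻¹][X]).degree = 2 :=
  degree_X_pow_sub_C (by norm_num) _

theorem yCoeff_add_mul_root (a b : K[T;T⁻¹]) :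
    yCoeff F (AdjoinRoot.of _ a + AdjoinRoot.of _ b * AdjoinRoot.root _) = b := by
  have h : (AdjoinRoot.of _ a + AdjoinRoot.of _ b * AdjoinRoot.root _ : OverlapRing F) =
      AdjoinRoot.mk _ (C b * X + C a) := by
    rw [map_add, map_mul, AdjoinRoot.mk_C, AdjoinRoot.mk_C, AdjoinRoot.mk_X, add_comm]
  change ((AdjoinRoot.modByMonicHom (monic_overlap F)) _).coeff 1 = b
  rw [h, AdjoinRoot.modByMonicHom_mk, (modByMonic_eq_self_iff (monic_overlap F)).2]
  · simp
  · rw [degree_overlap]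
    exact degree_linear_le.trans_lt (by norm_num)

theorem exists_eq_add_mul_root (z : OverlapRing F) :
    ∃ a b, z = AdjoinRoot.of _ a + AdjoinRoot.of _ b * AdjoinRoot.root _ := by
  obtain ⟨P, hP⟩ : ∃ P, P = AdjoinRoot.modByMonicHom (monic_overlap F) z := ⟨_, rfl⟩
  have hz : AdjoinRoot.mk _ P = z := by
    rw [hP]
    exact AdjoinRoot.mk_leftInverse (monic_overlap F) z
  have hdeg : P.degree ≤ 1 := by
    obtain ⟨Q, rfl⟩ := AdjoinRoot.mk_surjective z
    rw [hP, AdjoinRoot.modByMonicHom_mk]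
    refine Order.le_of_lt_succ ((degree_modByMonic_lt _ (monic_overlap F)).trans_le ?_)
    rw [degree_overlap]
    exact le_rfl
  refine ⟨P.coeff 0, P.coeff 1, ?_⟩
  rw [← hz, eq_X_add_C_of_degree_le_one hdeg]
  simp [add_comm]

/-- The functions `a + b e y` with `a` and `b` in a ring `A` that contains `(e y) ^ 2`. -/
def pairSubalgebra (A : Subalgebra K K[T;T⁻¹]) (e : K[T;T⁻¹]) (h : e * e * toLaurent F ∈ A) :
    Subalgebra K (OverlapRing F) where
  carrier := {z | ∃ a ∈ A, ∃ b ∈ A,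
    z = AdjoinRoot.of _ a + AdjoinRoot.of _ (b * e) * AdjoinRoot.root _}
  mul_mem' := by
    rintro _ _ ⟨a, ha, b, hb, rfl⟩ ⟨c, hc, d, hd, rfl⟩
    refine ⟨a * c + b * d * (e * e * toLaurent F), add_mem (mul_mem ha hc)
      (mul_mem (mul_mem hb hd) h), a * d + b * c, add_mem (mul_mem ha hd) (mul_mem hb hc), ?_⟩
    simp only [map_add, map_mul]
    rw [← root_sq]
    ring
  add_mem' := by
    rintro _ _ ⟨a, ha, b, hb, rfl⟩ ⟨c, hc, d, hd, rfl⟩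
    refine ⟨a + c, add_mem ha hc, b + d, add_mem hb hd, ?_⟩
    simp only [map_add, map_mul]
    ring
  algebraMap_mem' r := ⟨algebraMap K _ r, A.algebraMap_mem r, 0, zero_mem _, by
    rw [zero_mul, map_zero, zero_mul, add_zero]; rfl⟩

/-- Functions on `Z ≠ 0` are of the form `a(x) + b(x) y` with polynomials `a` and `b`. -/
theorem chartZ_le : chartZ F ≤ pairSubalgebra (toLaurentAlg (R := K)).range 1
    (by rw [one_mul, one_mul]; exact ⟨F, rfl⟩) := by
  refine Algebra.adjoin_le ?_
  rintro z (rfl | rfl)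
  · exact ⟨T 1, ⟨X, by simp⟩, 0, zero_mem _, by simp⟩
  · exact ⟨0, zero_mem _, 1, one_mem _, by simp⟩

/-- `x⁻⁶ F(x)` is a polynomial in `x⁻¹`. -/
theorem T_neg_mul_mem (hF : F.natDegree ≤ 6) : (T (-3) * T (-3) * toLaurent F : K[T;T⁻¹]) ∈
    ((LaurentPolynomial.invert (R := K)).toAlgHom.comp toLaurentAlg).range := by
  rw [F.as_sum_range' 7 (by omega), map_sum, Finset.mul_sum]
  refine sum_mem fun i hi => ⟨monomial (6 - i) (F.coeff i), ?_⟩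
  have hi6 : i ≤ 6 := by
    rw [Finset.mem_range] at hi
    omega
  change LaurentPolynomial.invert (toLaurent _) = _
  rw [← C_mul_X_pow_eq_monomial, ← C_mul_X_pow_eq_monomial, toLaurent_C_mul_X_pow,
    toLaurent_C_mul_X_pow, map_mul, LaurentPolynomial.invert_T, LaurentPolynomial.invert_C,
    ← LaurentPolynomial.T_add, mul_left_comm, ← LaurentPolynomial.T_add]
  congr 2
  push_cast [hi6]
  ring

/-- Functions on `X ≠ 0` are of the form `a(x⁻¹) + b(x⁻¹) x⁻³ y` with polynomials `a` and `b`. -/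
theorem chartX_le (hF : F.natDegree ≤ 6) : chartX F ≤ pairSubalgebra
    ((LaurentPolynomial.invert (R := K)).toAlgHom.comp toLaurentAlg).range (T (-3))
    (T_neg_mul_mem hF) := by
  refine Algebra.adjoin_le ?_
  rintro z (rfl | rfl)
  · exact ⟨T (-1), ⟨X, by simp⟩, 0, zero_mem _, by simp⟩
  · exact ⟨0, zero_mem _, 1, one_mem _, by simp⟩

theorem coeff_toLaurent_of_neg (f : K[X]) {n : ℤ} (hn : n < 0) : (toLaurent f).coeff n = 0 := by
  rw [LaurentPolynomial.coeff_toLaurent, Finsupp.mapDomain_of_notMem_range]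
  rintro ⟨m, rfl⟩
  exact absurd hn (by simp)

theorem coeff_toLaurent_natCast (f : K[X]) (n : ℕ) : (toLaurent f).coeff n = f.coeff n := by
  rw [LaurentPolynomial.coeff_toLaurent]
  exact Finsupp.mapDomain_apply Nat.castEmbedding.injective _ n

variable (F) in
/-- The coefficients of `x⁻¹ y` and `x⁻² y`. -/
def poleCoeffs : OverlapRing F →ₗ[K] K × K :=
  (((Finsupp.lapply (-1)).comp (AddMonoidAlgebra.coeffLinearEquiv K).toLinearMap).prod
    ((Finsupp.lapply (-2)).comp (AddMonoidAlgebra.coeffLinearEquiv K).toLinearMap)).comp (yCoeff F)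

theorem poleCoeffs_add_mul_root (a b : K[T;T⁻¹]) :
    poleCoeffs F (AdjoinRoot.of _ a + AdjoinRoot.of _ b * AdjoinRoot.root _) =
      (b.coeff (-1), b.coeff (-2)) := by
  conv_rhs => rw [← yCoeff_add_mul_root (F := F) a b]
  rfl

theorem charts_le_ker (hF : F.natDegree ≤ 6) :
    Subalgebra.toSubmodule (chartZ F) ⊔ Subalgebra.toSubmodule (chartX F) ≤
      LinearMap.ker (poleCoeffs F) := by
  refine sup_le (fun z hz => ?_) (fun z hz => ?_)
  · obtain ⟨a, -, b, ⟨b, rfl⟩, rfl⟩ := chartZ_le hz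
    rw [LinearMap.mem_ker, poleCoeffs_add_mul_root, mul_one]
    exact Prod.ext (coeff_toLaurent_of_neg b (by norm_num))
      (coeff_toLaurent_of_neg b (by norm_num))
  · obtain ⟨a, -, b, ⟨b, rfl⟩, rfl⟩ := chartX_le hF hz
    have h (n : ℕ) (hn : n < 3) :
        (LaurentPolynomial.invert (toLaurent b) * T (-3)).coeff (-n) = 0 := by
      rw [show (LaurentPolynomial.invert (toLaurent b) * T (-3) : K[T;T⁻¹]) =
        LaurentPolynomial.invert (toLaurent (b * X ^ 3)) by simp [toLaurent_X_pow],
        LaurentPolynomial.invert_apply, neg_neg, coeff_toLaurent_natCast, coeff_mul_X_pow',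
        if_neg (by omega)]
    rw [LinearMap.mem_ker, poleCoeffs_add_mul_root]
    exact Prod.ext (h 1 (by norm_num)) (h 2 (by norm_num))

theorem of_T_mem_chartZ (n : ℕ) : AdjoinRoot.of _ (T n) ∈ chartZ F := by
  rw [show (T n : K[T;T⁻¹]) = T 1 ^ n by rw [LaurentPolynomial.T_pow, mul_one], map_pow]
  exact (chartZ F).pow_mem (Algebra.subset_adjoin (Or.inl rfl)) n

theorem of_T_neg_mem_chartX (n : ℕ) : AdjoinRoot.of _ (T (-n)) ∈ chartX F := by
  rw [show (T (-n) : K[T;T⁻¹]) = T (-1) ^ n by rw [LaurentPolynomial.T_pow, mul_neg_one], map_pow]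
  exact (chartX F).pow_mem (Algebra.subset_adjoin (Or.inl rfl)) n

theorem of_C_mul (c : K) (a : K[T;T⁻¹]) :
    (AdjoinRoot.of _ (LaurentPolynomial.C c * a) : OverlapRing F) = c • AdjoinRoot.of _ a := by
  rw [map_mul, Algebra.smul_def]
  rfl

theorem of_mem_charts (a : K[T;T⁻¹]) : (AdjoinRoot.of _ a : OverlapRing F) ∈
    Subalgebra.toSubmodule (chartZ F) ⊔ Subalgebra.toSubmodule (chartX F) := by
  induction a using LaurentPolynomial.induction_on' with
  | add a b ha hb =>
    rw [map_add]
    exact add_mem ha hb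
  | C_mul_T n c =>
    rw [of_C_mul]
    refine Submodule.smul_mem _ _ ?_
    obtain ⟨m, rfl | rfl⟩ := n.eq_nat_or_neg
    · exact Submodule.mem_sup_left (of_T_mem_chartZ m)
    · exact Submodule.mem_sup_right (of_T_neg_mem_chartX m)

theorem of_T_mul_root_mem_charts {n : ℤ} (h1 : n ≠ -1) (h2 : n ≠ -2) :
    (AdjoinRoot.of _ (T n) * AdjoinRoot.root _ : OverlapRing F) ∈
    Subalgebra.toSubmodule (chartZ F) ⊔ Subalgebra.toSubmodule (chartX F) := by
  by_cases hn : 0 ≤ n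
  · lift n to ℕ using hn
    exact Submodule.mem_sup_left
      ((chartZ F).mul_mem (of_T_mem_chartZ n) (Algebra.subset_adjoin (Or.inr rfl)))
  · obtain ⟨m, hm⟩ := Int.eq_ofNat_of_zero_le (show 0 ≤ -3 - n by omega)
    refine Submodule.mem_sup_right ?_
    rw [show n = -(m : ℤ) + -3 by omega, LaurentPolynomial.T_add, map_mul, mul_assoc]
    exact (chartX F).mul_mem (of_T_neg_mem_chartX m) (Algebra.subset_adjoin (Or.inr rfl))

/-- Every `b y` is, up to `x⁻¹ y` and `x⁻² y`, the sum of a function on each chart. -/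
theorem of_mul_root_mem_charts (b : K[T;T⁻¹]) :
    (AdjoinRoot.of _ b * AdjoinRoot.root _ -
      b.coeff (-1) • (AdjoinRoot.of _ (T (-1)) * AdjoinRoot.root _) -
      b.coeff (-2) • (AdjoinRoot.of _ (T (-2)) * AdjoinRoot.root _) : OverlapRing F) ∈
    Subalgebra.toSubmodule (chartZ F) ⊔ Subalgebra.toSubmodule (chartX F) := by
  induction b using LaurentPolynomial.induction_on' with
  | add a b ha hb =>
    convert add_mem ha hb using 1
    rw [map_add, AddMonoidAlgebra.coeff_add, Finsupp.add_apply, Finsupp.add_apply, add_smul,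
      add_smul]
    ring
  | C_mul_T n c =>
    rw [of_C_mul, ← LaurentPolynomial.single_eq_C_mul_T]
    simp only [AddMonoidAlgebra.coeff_single, Finsupp.single_apply]
    by_cases h1 : n = -1
    · subst h1
      simp
    by_cases h2 : n = -2
    · subst h2
      simp
    rw [if_neg h1, if_neg h2, zero_smul, zero_smul, sub_zero, sub_zero, smul_mul_assoc]
    exact Submodule.smul_mem _ _ (of_T_mul_root_mem_charts h1 h2)

theorem ker_le_charts : LinearMap.ker (poleCoeffs F) ≤
    Subalgebra.toSubmodule (chartZ F) ⊔ Subalgebra.toSubmodule (chartX F) := by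
  intro z hz
  obtain ⟨a, b, rfl⟩ := exists_eq_add_mul_root z
  rw [LinearMap.mem_ker, poleCoeffs_add_mul_root, Prod.mk_eq_zero] at hz
  have h := of_mul_root_mem_charts (F := F) b
  rw [hz.1, hz.2, zero_smul, zero_smul, sub_zero, sub_zero] at h
  exact add_mem (of_mem_charts a) h

theorem poleCoeffs_surjective : Function.Surjective (poleCoeffs F) := by
  rintro ⟨c, d⟩
  refine ⟨AdjoinRoot.of _ 0 + AdjoinRoot.of _ (LaurentPolynomial.C c * T (-1) +
    LaurentPolynomial.C d * T (-2)) * AdjoinRoot.root _, ?_⟩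
  rw [poleCoeffs_add_mul_root]
  simp [← LaurentPolynomial.single_eq_C_mul_T]

theorem genus_eq_two (hF : F.natDegree ≤ 6) : genus F = 2 := by
  have h : Subalgebra.toSubmodule (chartZ F) ⊔ Subalgebra.toSubmodule (chartX F) =
      LinearMap.ker (poleCoeffs F) := le_antisymm (charts_le_ker hF) ker_le_charts
  rw [genus, h, ((poleCoeffs F).quotKerEquivOfSurjective poleCoeffs_surjective).finrank_eq]
  simp

end Genus

/-! ### Smoothness and irreducibility -/

section EvenSextic

variable {K : Type*} [Field K]

/-- The sextic `u (X ^ 2 - r) (X ^ 2 - s) (X ^ 2 - t)`. -/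
def evenSextic (u r s t : K) : K[X] :=
  C u * ((X ^ 2 - C r) * (X ^ 2 - C s) * (X ^ 2 - C t))

theorem natDegree_evenSextic_le (u r s t : K) : (evenSextic u r s t).natDegree ≤ 6 := by
  unfold evenSextic
  compute_degree

theorem curveEquation_evenSextic (u r s t : K) : curveEquation (evenSextic u r s t) =
    MvPolynomial.X 1 ^ 2 - MvPolynomial.C u *
      ((MvPolynomial.X 0 ^ 2 - MvPolynomial.C r * MvPolynomial.X 2 ^ 2) *
        (MvPolynomial.X 0 ^ 2 - MvPolynomial.C s * MvPolynomial.X 2 ^ 2) *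
        (MvPolynomial.X 0 ^ 2 - MvPolynomial.C t * MvPolynomial.X 2 ^ 2)) := by
  have h : evenSextic u r s t = C u * X ^ 6 + C (-u * (r + s + t)) * X ^ 4 +
      C (u * (r * s + r * t + s * t)) * X ^ 2 + C (-u * (r * s * t)) := by
    simp only [evenSextic, map_add, map_mul, map_neg]
    ring
  have hc (n : ℕ) : (evenSextic u r s t).coeff n = (if n = 6 then u else 0) +
      (if n = 4 then -u * (r + s + t) else 0) + (if n = 2 then u * (r * s + r * t + s * t) else 0) +
      (if n = 0 then -u * (r * s * t) else 0) := by
    rw [h]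
    simp only [coeff_add, coeff_C_mul, coeff_X_pow, coeff_C, mul_ite, mul_one, mul_zero]
  simp only [curveEquation, hc, Finset.sum_range_succ, Finset.sum_range_zero]
  norm_num
  ring

theorem onCurve_evenSextic_iff {L : Type*} [Field L] [Algebra K L] (u r s t : K) (v : Fin 3 → L) :
    OnCurve (evenSextic u r s t) v ↔ (v 0 ≠ 0 ∨ v 2 ≠ 0) ∧ v 1 ^ 2 = algebraMap K L u *
      ((v 0 ^ 2 - algebraMap K L r * v 2 ^ 2) * (v 0 ^ 2 - algebraMap K L s * v 2 ^ 2) *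
        (v 0 ^ 2 - algebraMap K L t * v 2 ^ 2)) := by
  rw [OnCurve, curveEquation_evenSextic]
  simp [sub_eq_zero]

/-- The derivative of the sextic form along `X` is nonzero at a zero of its factor `X² - r Z²`. -/
theorem pderiv_sextic_ne_zero {L : Type*} [Field L] {u r s t x z : L} (h2 : (2 : L) ≠ 0)
    (hu : u ≠ 0)
    (hr : r ≠ 0) (hrs : r ≠ s) (hrt : r ≠ t) (hxz : x ≠ 0 ∨ z ≠ 0) (h : x ^ 2 - r * z ^ 2 = 0) :
    2 * u * x * ((x ^ 2 - s * z ^ 2) * (x ^ 2 - t * z ^ 2)) ≠ 0 := by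
  have hx2 : x ^ 2 = r * z ^ 2 := sub_eq_zero.1 h
  have hz : z ≠ 0 := by
    rintro rfl
    rcases hxz with hx | hz
    · apply hx
      simpa using hx2
    · exact hz rfl
  have hx : x ≠ 0 := by
    rintro rfl
    have : r * z ^ 2 = 0 := by rw [← hx2]; ring
    exact mul_ne_zero hr (pow_ne_zero 2 hz) this
  rw [hx2, ← sub_mul, ← sub_mul]
  have := sub_ne_zero.2 hrs
  have := sub_ne_zero.2 hrt
  positivity

theorem isSmooth_evenSextic (h2 : (2 : K) ≠ 0) {u r s t : K} (hu : u ≠ 0) (hr : r ≠ 0) (hs : s ≠ 0)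
    (ht : t ≠ 0) (hrs : r ≠ s) (hrt : r ≠ t) (hst : s ≠ t) : IsSmooth (evenSextic u r s t) := by
  intro v hv
  rw [onCurve_evenSextic_iff] at hv
  obtain ⟨hxz, hv⟩ := hv
  set φ := algebraMap K (AlgebraicClosure K) with hφ
  have hφi : Function.Injective φ := φ.injective
  have h2' : (2 : AlgebraicClosure K) ≠ 0 := by
    rw [← map_ofNat φ 2]
    exact (map_ne_zero φ).2 h2
  by_cases hy : v 1 = 0
  · refine ⟨0, ?_⟩
    rw [curveEquation_evenSextic]
    have key : MvPolynomial.aeval v (MvPolynomial.pderiv 0 (MvPolynomial.X 1 ^ 2 -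
        MvPolynomial.C u * ((MvPolynomial.X 0 ^ 2 - MvPolynomial.C r * MvPolynomial.X 2 ^ 2) *
        (MvPolynomial.X 0 ^ 2 - MvPolynomial.C s * MvPolynomial.X 2 ^ 2) *
        (MvPolynomial.X 0 ^ 2 - MvPolynomial.C t * MvPolynomial.X 2 ^ 2)) :
          MvPolynomial (Fin 3) K)) =
        -(2 * φ u * v 0 * ((v 0 ^ 2 - φ s * v 2 ^ 2) * (v 0 ^ 2 - φ t * v 2 ^ 2))) -
        (2 * φ u * v 0 * ((v 0 ^ 2 - φ r * v 2 ^ 2) * (v 0 ^ 2 - φ t * v 2 ^ 2))) -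
        (2 * φ u * v 0 * ((v 0 ^ 2 - φ r * v 2 ^ 2) * (v 0 ^ 2 - φ s * v 2 ^ 2))) := by
      simp [MvPolynomial.pderiv_X, Derivation.leibniz, Derivation.leibniz_pow]
      ring
    rw [key]
    rw [hy] at hv
    have hv' := (mul_eq_zero.1 (hv.symm.trans (zero_pow two_ne_zero))).resolve_left
      ((map_ne_zero φ).2 hu)
    have hu' := (map_ne_zero φ).2 hu
    rcases mul_eq_zero.1 hv' with h | h
    rcases mul_eq_zero.1 h with h | h
    · have := pderiv_sextic_ne_zero h2' hu'
        ((map_ne_zero φ).2 hr) (hφi.ne hrs) (hφi.ne hrt) hxz h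
      rw [h]
      simpa using this
    · have := pderiv_sextic_ne_zero h2' hu'
        ((map_ne_zero φ).2 hs) (hφi.ne hrs.symm) (hφi.ne hst) hxz h
      rw [h]
      simpa using this
    · have := pderiv_sextic_ne_zero h2' hu'
        ((map_ne_zero φ).2 ht) (hφi.ne hrt.symm) (hφi.ne hst.symm) hxz h
      rw [h]
      simpa using this
  · refine ⟨1, ?_⟩
    rw [curveEquation_evenSextic]
    have key : MvPolynomial.aeval v (MvPolynomial.pderiv 1 (MvPolynomial.X 1 ^ 2 -
        MvPolynomial.C u * ((MvPolynomial.X 0 ^ 2 - MvPolynomial.C r * MvPolynomial.X 2 ^ 2) *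
        (MvPolynomial.X 0 ^ 2 - MvPolynomial.C s * MvPolynomial.X 2 ^ 2) *
        (MvPolynomial.X 0 ^ 2 - MvPolynomial.C t * MvPolynomial.X 2 ^ 2)) :
          MvPolynomial (Fin 3) K)) = 2 * v 1 := by
      simp [MvPolynomial.pderiv_X, Derivation.leibniz, Derivation.leibniz_pow]
    rw [key]
    exact mul_ne_zero h2' hy

/-- A square root of the binary form `u (X² - r Z²) (X² - s Z²) (X² - t Z²)` would be a square root
of a polynomial with a simple root. -/
theorem irreducible_curveEquation {L : Type*} [Field L] [IsAlgClosed L] (h2 : (2 : L) ≠ 0)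
    {u r s t : L} (hu : u ≠ 0) (hr : r ≠ 0) (hrs : r ≠ s) (hrt : r ≠ t) :
    Irreducible (curveEquation (evenSextic u r s t)) := by
  -- regard the equation as a monic quadratic polynomial in `Y`
  let e := (MvPolynomial.renameEquiv L (Equiv.swap (0 : Fin 3) 1)).trans
    (MvPolynomial.finSuccEquiv L 2)
  rw [← MulEquiv.irreducible_iff e.toMulEquiv]
  set G : MvPolynomial (Fin 2) L := MvPolynomial.C u *
      ((MvPolynomial.X 0 ^ 2 - MvPolynomial.C r * MvPolynomial.X 1 ^ 2) *
        (MvPolynomial.X 0 ^ 2 - MvPolynomial.C s * MvPolynomial.X 1 ^ 2) *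
        (MvPolynomial.X 0 ^ 2 - MvPolynomial.C t * MvPolynomial.X 1 ^ 2)) with hG
  have he : e (curveEquation (evenSextic u r s t)) = X ^ 2 - C G := by
    rw [curveEquation_evenSextic, hG]
    have h0 : Equiv.swap (0 : Fin 3) 1 0 = Fin.succ 0 := by decide
    have h1 : Equiv.swap (0 : Fin 3) 1 1 = 0 := by decide
    have h2 : Equiv.swap (0 : Fin 3) 1 2 = Fin.succ 1 := by decide
    simp only [e, AlgEquiv.trans_apply, map_sub, map_mul, map_pow,
      MvPolynomial.renameEquiv_apply, MvPolynomial.rename_X, MvPolynomial.rename_C, h0, h1, h2,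
      MvPolynomial.finSuccEquiv_X_succ, MvPolynomial.finSuccEquiv_X_zero]
    simp [MvPolynomial.finSuccEquiv_apply]
  change Irreducible (e _)
  have hmonic : (X ^ 2 - C G : (MvPolynomial (Fin 2) L)[X]).Monic :=
    monic_X_pow_sub_C _ two_ne_zero
  have hdeg : (X ^ 2 - C G : (MvPolynomial (Fin 2) L)[X]).natDegree = 2 := natDegree_X_pow_sub_C
  rw [he, hmonic.irreducible_iff_roots_eq_zero_of_degree_le_three (by rw [hdeg])
    (by rw [hdeg]; norm_num), Multiset.eq_zero_iff_forall_notMem]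
  intro g hg
  have hg2 : g ^ 2 = G := by
    simpa [sub_eq_zero] using isRoot_of_mem_roots hg
  set h : L[X] := MvPolynomial.aeval ![X, 1] g with hh
  have hh2 : h ^ 2 = evenSextic u r s t := by
    rw [hh, ← map_pow, hg2, hG]
    simp [evenSextic]
  obtain ⟨α, hα⟩ := IsAlgClosed.exists_pow_nat_eq r (n := 2) (by norm_num)
  have hα0 : α ≠ 0 := by
    rintro rfl
    exact hr (by rw [← hα]; ring)
  have h0 : h.eval α = 0 := by
    rw [← pow_eq_zero_iff two_ne_zero, ← eval_pow, hh2]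
    simp [evenSextic, hα]
  have h1 : (derivative (evenSextic u r s t)).eval α = 0 := by
    rw [← hh2, derivative_pow, eval_mul, eval_mul, eval_pow, h0]
    simp
  have h3 : (derivative (evenSextic u r s t)).eval α = u * (2 * α) * (r - s) * (r - t) := by
    simp [evenSextic, hα]
    ring
  rw [h3] at h1
  have := sub_ne_zero.2 hrs
  have := sub_ne_zero.2 hrt
  revert h1
  positivity

theorem map_curveEquation {L : Type*} [Field L] (f : K →+* L) (u r s t : K) :
    MvPolynomial.map f (curveEquation (evenSextic u r s t)) =
      curveEquation (evenSextic (f u) (f r) (f s) (f t)) := by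
  simp [curveEquation_evenSextic]

theorem isGeometricallyIrreducible_evenSextic (h2 : (2 : K) ≠ 0) {u r s t : K} (hu : u ≠ 0)
    (hr : r ≠ 0) (hrs : r ≠ s) (hrt : r ≠ t) :
    IsGeometricallyIrreducible (evenSextic u r s t) := by
  rw [IsGeometricallyIrreducible, map_curveEquation]
  set φ := algebraMap K (AlgebraicClosure K)
  refine irreducible_curveEquation ?_ ((map_ne_zero φ).2 hu) ((map_ne_zero φ).2 hr)
    (φ.injective.ne hrs) (φ.injective.ne hrt)
  rw [← map_ofNat φ 2]
  exact (map_ne_zero φ).2 h2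

end EvenSextic

/-! ### Morphisms to an elliptic curve with a Legendre equation -/

section Morphisms

open WeierstrassCurve

theorem aeval_weighted_smul {K L : Type*} [Field K] [Field L] [Algebra K L]
    {A : MvPolynomial (Fin 3) K} {d : ℕ} (hA : A.IsWeightedHomogeneous (![1, 3, 1] : Fin 3 → ℕ) d)
    (c : L) (v : Fin 3 → L) :
    MvPolynomial.aeval ![c * v 0, c ^ 3 * v 1, c * v 2] A = c ^ d * MvPolynomial.aeval v A := by
  rw [MvPolynomial.aeval_def, MvPolynomial.aeval_def, MvPolynomial.eval₂_eq',
    MvPolynomial.eval₂_eq', Finset.mul_sum]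
  refine Finset.sum_congr rfl fun m hm => ?_
  have hd := hA (MvPolynomial.mem_support_iff.1 hm)
  rw [← hd]
  rw [Finsupp.weight_apply, Finsupp.sum_fintype]
  · simp only [Fin.prod_univ_three, Fin.sum_univ_three, Matrix.cons_val_zero, Matrix.cons_val_one,
      Matrix.cons_val, smul_eq_mul]
    ring
  · exact fun _ => zero_smul _ _

variable {K : Type*} [Field K] {E : WeierstrassCurve K}

theorem IsProjCoords.exists_ne_zero {L : Type*} [Field L] {E : WeierstrassCurve L}
    {P : E.toAffine.Point} {v : Fin 3 → L} (h : IsProjCoords P v) : ∃ i, v i ≠ 0 := by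
  cases P with
  | zero => exact ⟨1, h.2.1⟩
  | some x y _ => exact ⟨2, h.1⟩

theorem IsProjCoords.smul {L : Type*} [Field L] {E : WeierstrassCurve L}
    {P : E.toAffine.Point} {v w : Fin 3 → L} (h : IsProjCoords P v) {c : L} (hc : c ≠ 0)
    (hw : ∀ i, w i = c * v i) : IsProjCoords P w := by
  cases P with
  | zero => exact ⟨by rw [hw, h.1, mul_zero], by rw [hw]; exact mul_ne_zero hc h.2.1,
      by rw [hw, h.2.2, mul_zero]⟩
  | some x y _ => exact ⟨by rw [hw]; exact mul_ne_zero hc h.1, by rw [hw, hw, h.2.1]; ring,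
      by rw [hw, hw, h.2.2]; ring⟩

/-- Three weighted homogeneous polynomials of the same degree whose values on the curve are always
coordinates of a point of `E` define a morphism. -/
theorem exists_morphism (F : K[X]) {d : ℕ} (A : Fin 3 → MvPolynomial (Fin 3) K)
    (hA : ∀ i, (A i).IsWeightedHomogeneous (![1, 3, 1] : Fin 3 → ℕ) d)
    (h : ∀ v : Fin 3 → AlgebraicClosure K, OnCurve F v →
      ∃ P : (E.baseChange (AlgebraicClosure K)).toAffine.Point,
        IsProjCoords P fun i => MvPolynomial.aeval v (A i)) :
    ∃ σ : Morphism F E, ∀ (v : Fin 3 → AlgebraicClosure K) (hv : OnCurve F v),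
      IsProjCoords (σ.toFun (CurvePoint.mk v hv)) fun i => MvPolynomial.aeval v (A i) := by
  choose P hP using h
  let φ : CurvePoint F (AlgebraicClosure K) →
      (E.baseChange (AlgebraicClosure K)).toAffine.Point := fun q => P q.out.1 q.out.2
  have hφ (v : Fin 3 → AlgebraicClosure K) (hv : OnCurve F v) :
      IsProjCoords (φ (CurvePoint.mk v hv)) fun i => MvPolynomial.aeval v (A i) := by
    obtain ⟨c, hc⟩ := Quotient.mk_out (s := curveSetoid F (AlgebraicClosure K)) ⟨v, hv⟩
    refine (hP _ _).smul (pow_ne_zero d c.ne_zero) fun i => ?_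
    rw [← aeval_weighted_smul (hA i) (c : AlgebraicClosure K)]
    exact congrArg (fun w => MvPolynomial.aeval w (A i)) hc
  exact ⟨⟨φ, fun v hv => ⟨d, A, hA, (hφ v hv).exists_ne_zero, fun w hw _ => hφ w hw⟩⟩, hφ⟩

theorem equation_of_legendre {l : K} {D : VariableChange K} (hD : D • E = legendre l)
    {L : Type*} [Field L] [Algebra K L] {x y : L}
    (h : y ^ 2 = x * (x - 1) * (x - algebraMap K L l)) :
    (E.baseChange L).toAffine.Equation (algebraMap K L D.u ^ 2 * x + algebraMap K L D.r)
      (algebraMap K L D.u ^ 3 * y + algebraMap K L D.u ^ 2 * algebraMap K L D.s * x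
        + algebraMap K L D.t) := by
  have hu := D.u.ne_zero
  have e1 := congrArg WeierstrassCurve.a₁ hD
  have e2 := congrArg WeierstrassCurve.a₂ hD
  have e3 := congrArg WeierstrassCurve.a₃ hD
  have e4 := congrArg WeierstrassCurve.a₄ hD
  have e6 := congrArg WeierstrassCurve.a₆ hD
  rw [variableChange_a₁] at e1
  rw [variableChange_a₂] at e2
  rw [variableChange_a₃] at e3
  rw [variableChange_a₄] at e4
  rw [variableChange_a₆] at e6
  simp only [legendre, Units.val_inv_eq_inv_val, inv_pow] at e1 e2 e3 e4 e6
  rw [inv_mul_eq_iff_eq_mul₀ (by positivity)] at e1 e2 e3 e4 e6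
  replace e1 := congrArg (algebraMap K L) e1
  replace e2 := congrArg (algebraMap K L) e2
  replace e3 := congrArg (algebraMap K L) e3
  replace e4 := congrArg (algebraMap K L) e4
  replace e6 := congrArg (algebraMap K L) e6
  simp only [map_add, map_sub, map_mul, map_pow, map_neg, map_one, map_zero, map_ofNat]
    at e1 e2 e3 e4 e6
  rw [Affine.equation_iff]
  simp only [baseChange, map_a₁, map_a₂, map_a₃, map_a₄, map_a₆]
  set u := algebraMap K L D.u
  linear_combination u ^ 6 * h + u ^ 5 * x * y * e1 + u ^ 3 * y * e3 - u ^ 4 * x ^ 2 * e2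
    - u ^ 2 * x * e4 - e6

/-- A map to the Legendre curve, given by three forms, composed with the change of variables back to
`E`. At points where the last form vanishes the values are required to be coordinates of the point
at infinity. -/
theorem exists_morphism_of_legendre [E.IsElliptic] {l : K} {D : VariableChange K}
    (hD : D • E = legendre l) (F : K[X]) {d : ℕ} (B : Fin 3 → MvPolynomial (Fin 3) K)
    (hB : ∀ i, (B i).IsWeightedHomogeneous (![1, 3, 1] : Fin 3 → ℕ) d)
    (h : ∀ v : Fin 3 → AlgebraicClosure K, OnCurve F v →
      (MvPolynomial.aeval v (B 2) ≠ 0 ∧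
        MvPolynomial.aeval v (B 1) ^ 2 * MvPolynomial.aeval v (B 2) =
          MvPolynomial.aeval v (B 0) * (MvPolynomial.aeval v (B 0) - MvPolynomial.aeval v (B 2)) *
          (MvPolynomial.aeval v (B 0) - algebraMap K _ l * MvPolynomial.aeval v (B 2))) ∨
      (MvPolynomial.aeval v (B 0) = 0 ∧ MvPolynomial.aeval v (B 1) ≠ 0 ∧
        MvPolynomial.aeval v (B 2) = 0)) :
    ∃ σ : Morphism F E, ∀ (v : Fin 3 → AlgebraicClosure K) (hv : OnCurve F v)
      (x y : AlgebraicClosure K), MvPolynomial.aeval v (B 2) ≠ 0 →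
      MvPolynomial.aeval v (B 0) = x * MvPolynomial.aeval v (B 2) →
      MvPolynomial.aeval v (B 1) = y * MvPolynomial.aeval v (B 2) →
      HasCoords D (σ.toFun (CurvePoint.mk v hv)) x y := by
  have : (E.baseChange (AlgebraicClosure K)).IsElliptic :=
    inferInstanceAs (E.map (algebraMap K (AlgebraicClosure K))).IsElliptic
  let A : Fin 3 → MvPolynomial (Fin 3) K :=
    ![MvPolynomial.C ((D.u : K) ^ 2) * B 0 + MvPolynomial.C D.r * B 2,
      MvPolynomial.C ((D.u : K) ^ 3) * B 1 + MvPolynomial.C ((D.u : K) ^ 2 * D.s) * B 0 +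
        MvPolynomial.C D.t * B 2, B 2]
  have hC (c : K) (i : Fin 3) : (MvPolynomial.C c * B i).IsWeightedHomogeneous
      (![1, 3, 1] : Fin 3 → ℕ) d := by
    simpa using (MvPolynomial.isWeightedHomogeneous_C (![1, 3, 1] : Fin 3 → ℕ) c).mul (hB i)
  have hA (i : Fin 3) : (A i).IsWeightedHomogeneous (![1, 3, 1] : Fin 3 → ℕ) d := by
    fin_cases i
    · exact (hC _ _).add (hC _ _)
    · exact ((hC _ _).add (hC _ _)).add (hC _ _)
    · exact hB 2
  have hA0 (v : Fin 3 → AlgebraicClosure K) : MvPolynomial.aeval v (A 0) =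
      algebraMap K _ D.u ^ 2 * MvPolynomial.aeval v (B 0) +
        algebraMap K _ D.r * MvPolynomial.aeval v (B 2) := by
    simp [A]
  have hA1 (v : Fin 3 → AlgebraicClosure K) : MvPolynomial.aeval v (A 1) =
      algebraMap K _ D.u ^ 3 * MvPolynomial.aeval v (B 1) +
        algebraMap K _ D.u ^ 2 * algebraMap K _ D.s * MvPolynomial.aeval v (B 0) +
        algebraMap K _ D.t * MvPolynomial.aeval v (B 2) := by
    simp [A]
  have hA2 (v : Fin 3 → AlgebraicClosure K) :
      MvPolynomial.aeval v (A 2) = MvPolynomial.aeval v (B 2) := rfl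
  have hu : algebraMap K (AlgebraicClosure K) D.u ≠ 0 :=
    (map_ne_zero (algebraMap K (AlgebraicClosure K))).2 D.u.ne_zero
  obtain ⟨σ, hσ⟩ := exists_morphism (E := E) F A hA fun v hv => by
    rcases h v hv with ⟨hz, heq⟩ | ⟨hx, hy, hz⟩
    · refine ⟨.some _ _ (Affine.equation_iff_nonsingular.1 (equation_of_legendre hD
        (x := MvPolynomial.aeval v (B 0) / MvPolynomial.aeval v (B 2))
        (y := MvPolynomial.aeval v (B 1) / MvPolynomial.aeval v (B 2)) ?_)), ?_, ?_, ?_⟩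
      · field_simp
        linear_combination heq
      · exact hz
      · dsimp only
        rw [hA0, hA2]
        field_simp
      · dsimp only
        rw [hA1, hA2]
        field_simp
    · refine ⟨.zero, ?_, ?_, ?_⟩
      · dsimp only
        rw [hA0, hx, hz]
        ring
      · dsimp only
        rw [hA1, hx, hz]
        simpa [hu] using hy
      · exact hz
  refine ⟨σ, fun v hv x y hz hx hy => ?_⟩
  have h1 := hσ v hv
  generalize σ.toFun (CurvePoint.mk v hv) = P at h1 ⊢
  cases P with
  | zero => exact absurd h1.2.2 hz
  | some x' y' hn =>
    obtain ⟨-, h0, h1⟩ := h1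
    dsimp only at h0 h1
    rw [hA0, hA2, hx] at h0
    rw [hA1, hA2, hx, hy] at h1
    have hx' : x' = algebraMap K _ D.u ^ 2 * x + algebraMap K _ D.r := by
      apply mul_right_cancel₀ hz
      linear_combination -h0
    have hy' : y' = algebraMap K _ D.u ^ 3 * y + algebraMap K _ D.u ^ 2 * algebraMap K _ D.s * x +
        algebraMap K _ D.t := by
      apply mul_right_cancel₀ hz
      linear_combination -h1
    subst hx' hy'
    exact ⟨hn, rfl⟩

end Morphisms

/-! ### The two maps from the Scholten curve -/

section SpanningMaps

open MvPolynomial (aeval isWeightedHomogeneous_X)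

variable {K : Type*} [Field K] {E : WeierstrassCurve K} [E.IsElliptic]
  {D : WeierstrassCurve.VariableChange K}

theorem isWeightedHomogeneous_sq_sub (c : K) :
    (MvPolynomial.X 0 ^ 2 - MvPolynomial.C c * MvPolynomial.X 2 ^ 2 :
      MvPolynomial (Fin 3) K).IsWeightedHomogeneous (![1, 3, 1] : Fin 3 → ℕ) 2 := by
  have h0 := (isWeightedHomogeneous_X K (![1, 3, 1] : Fin 3 → ℕ) 0).pow 2
  have h2 := ((isWeightedHomogeneous_X K (![1, 3, 1] : Fin 3 → ℕ) 2).pow 2).C_mul c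
  exact h0.sub h2

/-- If `u r`, `u s`, `u t` are the translates of `0`, `1`, `l` by `u v`, then
`(X, Y) ↦ (u (X² - v), u Y)` is a morphism to the Legendre curve with parameter `l`. -/
theorem exists_morphism_polynomial {l u r s t v : K} (hD : D • E = legendre l) (hu : u ≠ 0)
    (h1 : u * (r - v) + u * (s - v) + u * (t - v) = 1 + l)
    (h2 : u * (r - v) * (u * (s - v)) + u * (r - v) * (u * (t - v)) +
      u * (s - v) * (u * (t - v)) = l)
    (h3 : u * (r - v) * (u * (s - v)) * (u * (t - v)) = 0) :
    ∃ σ : Morphism (evenSextic u r s t) E,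
      ∀ (x y : AlgebraicClosure K) (h : OnCurve (evenSextic u r s t) ![x, y, 1]),
        HasCoords D (σ.toFun (CurvePoint.mk ![x, y, 1] h))
          (algebraMap K _ u * (x ^ 2 - algebraMap K _ v)) (algebraMap K _ u * y) := by
  set φ := algebraMap K (AlgebraicClosure K) with hφ
  let B : Fin 3 → MvPolynomial (Fin 3) K :=
    ![MvPolynomial.C u * (MvPolynomial.X 0 ^ 2 - MvPolynomial.C v * MvPolynomial.X 2 ^ 2) *
      MvPolynomial.X 2, MvPolynomial.C u * MvPolynomial.X 1, MvPolynomial.X 2 ^ 3]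
  have hB (i : Fin 3) : (B i).IsWeightedHomogeneous (![1, 3, 1] : Fin 3 → ℕ) 3 := by
    fin_cases i
    · exact ((isWeightedHomogeneous_sq_sub v).C_mul u).mul (isWeightedHomogeneous_X K _ 2)
    · exact (isWeightedHomogeneous_X K _ 1).C_mul u
    · exact (isWeightedHomogeneous_X K _ 2).pow 3
  have hB0 (w : Fin 3 → AlgebraicClosure K) :
      aeval w (B 0) = φ u * (w 0 ^ 2 - φ v * w 2 ^ 2) * w 2 := by simp [B, hφ]
  have hB1 (w : Fin 3 → AlgebraicClosure K) : aeval w (B 1) = φ u * w 1 := by simp [B, hφ]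
  have hB2 (w : Fin 3 → AlgebraicClosure K) : aeval w (B 2) = w 2 ^ 3 := by simp [B]
  have hu' : φ u ≠ 0 := (map_ne_zero φ).2 hu
  obtain ⟨σ, hσ⟩ := exists_morphism_of_legendre hD (evenSextic u r s t) B hB fun w hw => by
    rw [onCurve_evenSextic_iff] at hw
    obtain ⟨hxz, hw⟩ := hw
    rw [hB0, hB1, hB2]
    by_cases hz : w 2 = 0
    · refine Or.inr ⟨by rw [hz, mul_zero], mul_ne_zero hu' fun hy => ?_, by rw [hz]; ring⟩
      have hx : w 0 ≠ 0 := hxz.resolve_right (not_not.2 hz)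
      rw [hy, hz] at hw
      refine mul_ne_zero hu' (pow_ne_zero 6 hx) ?_
      linear_combination -hw
    · refine Or.inl ⟨pow_ne_zero 3 hz, ?_⟩
      replace h1 := congrArg φ h1
      replace h2 := congrArg φ h2
      replace h3 := congrArg φ h3
      simp only [map_add, map_sub, map_mul, map_one, map_zero] at h1 h2 h3
      rw [← hφ] at hw ⊢
      linear_combination φ u ^ 2 * w 2 ^ 3 * hw -
        w 2 ^ 3 * ((φ u * (w 0 ^ 2 - φ v * w 2 ^ 2)) ^ 2 * w 2 ^ 2 * h1 -
          (φ u * (w 0 ^ 2 - φ v * w 2 ^ 2)) * w 2 ^ 4 * h2 + w 2 ^ 6 * h3)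
  refine ⟨σ, fun x y h => hσ _ h _ _ ?_ ?_ ?_⟩
  · rw [hB2]
    simp
  · rw [hB0, hB2]
    simp
  · rw [hB1, hB2]
    simp

/-- The morphism `(X, Y) ↦ (u s t (X² - r) X⁻², -u r s t X⁻³ Y)` to a Legendre curve. -/
theorem exists_morphism_laurent {m u r s t : K} (hD : D • E = legendre m) (hu : u ≠ 0)
    (hr : r ≠ 0) (hs : s ≠ 0) (ht : t ≠ 0) (h1 : u * s * (t - r) = 1) (hm : u * t * (s - r) = m) :
    ∃ σ : Morphism (evenSextic u r s t) E,
      ∀ (x y : AlgebraicClosure K) (h : OnCurve (evenSextic u r s t) ![x, y, 1]), x ≠ 0 →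
        HasCoords D (σ.toFun (CurvePoint.mk ![x, y, 1] h))
          (algebraMap K _ (u * s * t) * (x ^ 2 - algebraMap K _ r) * (x ^ 2)⁻¹)
          (-(algebraMap K _ (u * r * s * t)) * (x ^ 3)⁻¹ * y) := by
  set φ := algebraMap K (AlgebraicClosure K) with hφ
  let B : Fin 3 → MvPolynomial (Fin 3) K :=
    ![MvPolynomial.C (u * s * t) *
      (MvPolynomial.X 0 ^ 2 - MvPolynomial.C r * MvPolynomial.X 2 ^ 2) * MvPolynomial.X 0,
      MvPolynomial.C (-(u * r * s * t)) * MvPolynomial.X 1, MvPolynomial.X 0 ^ 3]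
  have hB (i : Fin 3) : (B i).IsWeightedHomogeneous (![1, 3, 1] : Fin 3 → ℕ) 3 := by
    fin_cases i
    · exact ((isWeightedHomogeneous_sq_sub r).C_mul _).mul (isWeightedHomogeneous_X K _ 0)
    · exact (isWeightedHomogeneous_X K _ 1).C_mul _
    · exact (isWeightedHomogeneous_X K _ 0).pow 3
  have hB0 (w : Fin 3 → AlgebraicClosure K) :
      aeval w (B 0) = φ (u * s * t) * (w 0 ^ 2 - φ r * w 2 ^ 2) * w 0 := by simp [B, hφ]
  have hB1 (w : Fin 3 → AlgebraicClosure K) : aeval w (B 1) = -φ (u * r * s * t) * w 1 := by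
    simp [B, hφ]
  have hB2 (w : Fin 3 → AlgebraicClosure K) : aeval w (B 2) = w 0 ^ 3 := by simp [B]
  have hne : φ (u * r * s * t) ≠ 0 := (map_ne_zero φ).2 (by positivity)
  obtain ⟨σ, hσ⟩ := exists_morphism_of_legendre hD (evenSextic u r s t) B hB fun w hw => by
    rw [onCurve_evenSextic_iff] at hw
    obtain ⟨hxz, hw⟩ := hw
    rw [hB0, hB1, hB2]
    by_cases hx : w 0 = 0
    · refine Or.inr ⟨by rw [hx, mul_zero], mul_ne_zero (neg_ne_zero.2 hne) fun hy => ?_,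
        by rw [hx]; ring⟩
      have hz : w 2 ≠ 0 := hxz.resolve_left (not_not.2 hx)
      rw [hy, hx] at hw
      refine mul_ne_zero hne (pow_ne_zero 6 hz) ?_
      simp only [map_mul]
      linear_combination hw
    · refine Or.inl ⟨pow_ne_zero 3 hx, ?_⟩
      replace h1 := congrArg φ h1
      simp only [map_sub, map_mul, map_one] at h1
      rw [← hm, ← hφ]
      rw [← hφ] at hw
      simp only [map_sub, map_mul]
      have e1 : φ u * φ s * φ t * (w 0 ^ 2 - φ r * w 2 ^ 2) - w 0 ^ 2 =
          φ u * φ r * φ s * (w 0 ^ 2 - φ t * w 2 ^ 2) := by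
        linear_combination w 0 ^ 2 * h1
      calc _ = (φ u * φ r * φ s * φ t) ^ 2 * w 0 ^ 3 * w 1 ^ 2 := by ring
        _ = φ u * φ s * φ t * (w 0 ^ 2 - φ r * w 2 ^ 2) *
          (φ u * φ r * φ s * (w 0 ^ 2 - φ t * w 2 ^ 2)) *
          (φ u * φ r * φ t * (w 0 ^ 2 - φ s * w 2 ^ 2)) * w 0 ^ 3 := by
            rw [hw]
            ring
        _ = _ := by
          rw [← e1]
          ring
  refine ⟨σ, fun x y h hx => hσ _ h _ _ ?_ ?_ ?_⟩
  · rw [hB2]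
    simpa using hx
  · rw [hB0, hB2]
    simp only [Matrix.cons_val_zero, Matrix.cons_val]
    field_simp
  · rw [hB1, hB2]
    simp only [Matrix.cons_val_zero, Matrix.cons_val_one]
    field_simp

end SpanningMaps

/-! ### The choice of the Scholten curve -/

section Choice

variable {p : ℕ} [Fact p.Prime] {K : Type*} [Field K] [Algebra ℚ_[p] K] [FiniteDimensional ℚ_[p] K]

theorem isUnit_add_mul_of_not_isUnit {R : Type*} [CommRing R] [IsLocalRing R] {x n : R}
    (hx : IsUnit x) (hn : ¬ IsUnit n) (y : R) : IsUnit (x + y * n) := by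
  rw [← IsLocalRing.residue_ne_zero_iff_isUnit] at hx hn ⊢
  rwa [map_add, map_mul, not_not.1 hn, mul_zero, add_zero]

/-- One of the six pairs gives a curve with good reduction for which `a` is a square. The pair
`(1, l)` serves unless `l` and `m` are congruent modulo `𝔪`; if they are, one of `l`, `1 - l`,
`l - 1` is a square, and the curve of the corresponding pair has good reduction because neither `-1`
is a square nor `l` a primitive sixth root of unity modulo `𝔪`. -/
theorem exists_pair (hK : IsTotallyRamified p K) (h4 : p % 4 = 3) {l m : integers p K}
    (hl : IsUnit l) (hl1 : IsUnit (1 - l)) (hl6 : IsUnit (l ^ 2 - l + 1)) :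
    ∃ a b : integers p K, ((a = 1 ∧ b = l) ∨ (a = l ∧ b = 1) ∨ (a = l - 1 ∧ b = -1) ∨
        (a = 1 - l ∧ b = -l)) ∧ IsUnit (a * m - b) ∧ IsSquare a := by
  by_cases hn : IsUnit (m - l)
  · exact ⟨1, l, Or.inl ⟨rfl, rfl⟩, by rwa [one_mul], IsSquare.one⟩
  by_cases hsq : IsSquare l
  · refine ⟨l, 1, Or.inr (Or.inl ⟨rfl, rfl⟩), ?_, hsq⟩
    obtain ⟨c, hc⟩ := hsq
    have h := hl1.neg.mul (isUnit_sq_add_one hK h4 c)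
    rw [pow_two, ← hc] at h
    convert isUnit_add_mul_of_not_isUnit h hn l using 1
    ring
  rcases isSquare_or_isSquare_neg hK h4 hl1 with h | h
  · refine ⟨1 - l, -l, Or.inr (Or.inr (Or.inr ⟨rfl, rfl⟩)), ?_, h⟩
    obtain ⟨c, hc⟩ := h
    have h := hl.mul (isUnit_sq_add_one hK h4 c)
    rw [pow_two, ← hc] at h
    convert isUnit_add_mul_of_not_isUnit h hn (1 - l) using 1
    ring
  · refine ⟨l - 1, -1, Or.inr (Or.inr (Or.inl ⟨rfl, rfl⟩)), ?_, by rwa [neg_sub] at h⟩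
    convert isUnit_add_mul_of_not_isUnit hl6 hn (l - 1) using 1
    ring

theorem scholtenSextic_eq_evenSextic {K : Type*} [Field K] {a b m : K} (ha : a ≠ 0) (hb : b ≠ 0)
    (hab : a - b ≠ 0) : scholtenSextic a b 1 m =
      evenSextic ((a - b) * a * b * (a * m - b)⁻¹) ((1 - m) * (a - b)⁻¹) a⁻¹ (m * b⁻¹) := by
  have key (c d : K) (hc : c ≠ 0) : C c * X ^ 2 - C d = C c * (X ^ 2 - C (d * c⁻¹)) := by
    rw [mul_sub, ← C_mul, mul_comm d, mul_inv_cancel_left₀ hc]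
  rw [scholtenSextic, evenSextic, key _ _ hab, key _ _ ha, key _ _ hb, mul_one, one_mul]
  simp only [C_mul]
  ring

theorem coe_units_inv {K : Type*} [Field K] {A : ValuationSubring K} (x : Aˣ) :
    (((x⁻¹ : Aˣ) : A) : K) = ((x : A) : K)⁻¹ := by
  apply eq_inv_of_mul_eq_one_left
  rw [← MulMemClass.coe_mul, Units.inv_mul, OneMemClass.coe_one]

end Choice

end GenusTwoSpan

end

theorem mainTheorem5 (p : ℕ) [Fact p.Prime] (hp : 3 < p)
    (K : Type*) [Field K] [Algebra ℚ_[p] K] [FiniteDimensional ℚ_[p] K]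
    (hK : GenusTwoSpan.IsTotallyRamified p K)
    (E₁ E₂ : WeierstrassCurve K) [E₁.IsElliptic] [E₂.IsElliptic]
    (h₁ : GenusTwoSpan.HasFullTwoTorsion E₁) (h₂ : GenusTwoSpan.HasFullTwoTorsion E₂)
    (hs₁ : GenusTwoSpan.HasSupersingularReduction p (GenusTwoSpan.integers p K) E₁)
    (hs₂ : GenusTwoSpan.HasSupersingularReduction p (GenusTwoSpan.integers p K) E₂) :
    -- Legendre equations of the two curves
    ∃ (l m : GenusTwoSpan.integers p K) (D₁ D₂ : WeierstrassCurve.VariableChange K),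
      IsUnit l ∧ IsUnit (1 - l) ∧ IsUnit m ∧ IsUnit (1 - m) ∧
      D₁ • E₁ = GenusTwoSpan.legendre (l : K) ∧ D₂ • E₂ = GenusTwoSpan.legendre (m : K) ∧
      -- one of the six Scholten curves, and its equation
      ∃ (a b : K) (u r s t v w : (GenusTwoSpan.integers p K)ˣ) (F : K[X]),
        (a, b) ∈ ({(1, (l : K)), ((l : K), 1), (-1, (l : K) - 1), ((l : K) - 1, -1),
          (1 - (l : K), -(l : K)), (-(l : K), 1 - (l : K))} : Set (K × K)) ∧
        a * m - b * 1 ≠ 0 ∧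
        F = GenusTwoSpan.scholtenSextic a b 1 (m : K) ∧
        F = C (u : K) * ((X ^ 2 - C (r : K)) * (X ^ 2 - C (s : K)) * (X ^ 2 - C (t : K))) ∧
        -- the curve is smooth, geometrically irreducible, of genus two
        GenusTwoSpan.IsSmooth F ∧ GenusTwoSpan.IsGeometricallyIrreducible F ∧
        GenusTwoSpan.genus F = 2 ∧
        -- the two spanning maps, in Legendre coordinates
        (∃ σ₁ : GenusTwoSpan.Morphism F E₁,
          ∀ (x y : AlgebraicClosure K) (h : GenusTwoSpan.OnCurve F ![x, y, 1]),
            GenusTwoSpan.HasCoords D₁ (σ₁.toFun (GenusTwoSpan.CurvePoint.mk ![x, y, 1] h))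
              (algebraMap K _ (u : K) * (x ^ 2 - algebraMap K _ (v : K)))
              (algebraMap K _ (u : K) * y)) ∧
        (∃ σ₂ : GenusTwoSpan.Morphism F E₂,
          ∀ (x y : AlgebraicClosure K) (h : GenusTwoSpan.OnCurve F ![x, y, 1]), x ≠ 0 →
            GenusTwoSpan.HasCoords D₂ (σ₂.toFun (GenusTwoSpan.CurvePoint.mk ![x, y, 1] h))
              (algebraMap K _ ((u : K) * s * t) * (x ^ 2 - algebraMap K _ (r : K)) * (x ^ 2)⁻¹)
              (-(algebraMap K _ ((u : K) * r * s * t)) * (x ^ 3)⁻¹ * y)) ∧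
        -- the rational Weierstrass point
        ∃ h : GenusTwoSpan.OnCurve F ![(w : K), 0, 1],
          (GenusTwoSpan.CurvePoint.mk ![(w : K), 0, 1] h).involution =
            GenusTwoSpan.CurvePoint.mk ![(w : K), 0, 1] h := by
  have h2 : IsUnit (2 : GenusTwoSpan.integers p K) :=
    GenusTwoSpan.isUnit_natCast_of_lt hK (n := 2) (by norm_num) (by omega)
  have h2K : (2 : K) ≠ 0 := fun h => h2.ne_zero (Subtype.ext h)
  have hcoe {x : GenusTwoSpan.integers p K} (hx : IsUnit x) : (x : K) ≠ 0 :=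
    fun h => hx.ne_zero (Subtype.ext h)
  obtain ⟨h4, l, D₁, hl, hl1, hl6, hD₁⟩ := GenusTwoSpan.exists_legendre hp hK h₁ hs₁
  obtain ⟨-, m, D₂, hm, hm1, -, hD₂⟩ := GenusTwoSpan.exists_legendre hp hK h₂ hs₂
  refine ⟨l, m, D₁, D₂, hl, hl1, hm, hm1, hD₁, hD₂, ?_⟩
  obtain ⟨a, b, hpair, hd, c, hc⟩ := GenusTwoSpan.exists_pair hK h4 (m := m) hl hl1 hl6
  have hl1' : IsUnit (l - 1) := by simpa using hl1.neg
  obtain ⟨ha, hb, hab⟩ : IsUnit a ∧ IsUnit b ∧ IsUnit (a - b) := by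
    rcases hpair with ⟨rfl, rfl⟩ | ⟨rfl, rfl⟩ | ⟨rfl, rfl⟩ | ⟨rfl, rfl⟩
    · exact ⟨isUnit_one, hl, hl1⟩
    · exact ⟨hl, isUnit_one, hl1'⟩
    · exact ⟨hl1', isUnit_one.neg, by simpa using hl⟩
    · exact ⟨hl1, hl.neg, by simp⟩
  have hcu : IsUnit c := isUnit_of_mul_isUnit_left (hc ▸ ha)
  have ha0 := hcoe ha
  have hb0 := hcoe hb
  have hab0 : (a : K) - b ≠ 0 := hcoe hab
  have hm0 := hcoe hm
  have hm10 : 1 - (m : K) ≠ 0 := hcoe hm1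
  have hd0 : (a : K) * m - b ≠ 0 := hcoe hd
  have hc0 := hcoe hcu
  -- the parameters of the sextic, as units
  obtain ⟨u, hu⟩ : ∃ u : (GenusTwoSpan.integers p K)ˣ,
      (u : K) = (a - b) * a * b * ((a : K) * m - b)⁻¹ :=
    ⟨hab.unit * ha.unit * hb.unit * hd.unit⁻¹, by simp [GenusTwoSpan.coe_units_inv]⟩
  obtain ⟨r, hr⟩ : ∃ r : (GenusTwoSpan.integers p K)ˣ, (r : K) = (1 - m) * ((a : K) - b)⁻¹ :=
    ⟨hm1.unit * hab.unit⁻¹, by simp [GenusTwoSpan.coe_units_inv]⟩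
  obtain ⟨s, hs⟩ : ∃ s : (GenusTwoSpan.integers p K)ˣ, (s : K) = (a : K)⁻¹ :=
    ⟨ha.unit⁻¹, by simp [GenusTwoSpan.coe_units_inv]⟩
  obtain ⟨t, ht⟩ : ∃ t : (GenusTwoSpan.integers p K)ˣ, (t : K) = m * (b : K)⁻¹ :=
    ⟨hm.unit * hb.unit⁻¹, by simp [GenusTwoSpan.coe_units_inv]⟩
  obtain ⟨w, hw⟩ : ∃ w : (GenusTwoSpan.integers p K)ˣ, (w : K) = (c : K)⁻¹ :=
    ⟨hcu.unit⁻¹, by simp [GenusTwoSpan.coe_units_inv]⟩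
  have hu0 := hcoe u.isUnit
  have hr0 := hcoe r.isUnit
  have hs0 := hcoe s.isUnit
  have ht0 := hcoe t.isUnit
  -- the differences of the branch points
  have hsr : (u : K) * (s - r) = b := by
    rw [hu, hs, hr]
    field_simp
    ring
  have htr : (u : K) * (t - r) = a := by
    rw [hu, ht, hr]
    field_simp
    ring
  have hst : (u : K) * (s - t) = b - a := by linear_combination hsr - htr
  have hrs' : (r : K) ≠ s := fun h => hb0 (by rw [← hsr, h, sub_self, mul_zero])
  have hrt' : (r : K) ≠ t := fun h => ha0 (by rw [← htr, h, sub_self, mul_zero])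
  have hst' : (s : K) ≠ t := fun h => hab0 (by
    rw [h, sub_self, mul_zero] at hst
    linear_combination hst)
  -- `u (X² - v)` takes the values `0`, `1`, `l` at the branch points
  obtain ⟨v, hv1, hv2, hv3⟩ : ∃ v : (GenusTwoSpan.integers p K)ˣ,
      (u : K) * (r - v) + u * (s - v) + u * (t - v) = 1 + l ∧
      (u : K) * (r - v) * (u * (s - v)) + u * (r - v) * (u * (t - v)) +
        u * (s - v) * (u * (t - v)) = l ∧
      (u : K) * (r - v) * (u * (s - v)) * (u * (t - v)) = 0 := by
    rcases hpair with ⟨rfl, rfl⟩ | ⟨rfl, rfl⟩ | ⟨rfl, rfl⟩ | ⟨rfl, rfl⟩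
    · refine ⟨r, ?_, ?_, ?_⟩ <;> rw [hsr, htr] <;> simp [add_comm]
    · refine ⟨r, ?_, ?_, ?_⟩ <;> rw [hsr, htr] <;> simp
    · have e1 : (u : K) * (r - s) = 1 := by push_cast at hsr; linear_combination -hsr
      have e2 : (u : K) * (t - s) = l := by push_cast at hst; linear_combination -hst
      refine ⟨s, ?_, ?_, ?_⟩ <;> rw [e1, e2] <;> simp
    · have e1 : (u : K) * (r - s) = l := by push_cast at hsr; linear_combination -hsr
      have e2 : (u : K) * (t - s) = 1 := by push_cast at hst; linear_combination -hst
      refine ⟨s, ?_, ?_, ?_⟩ <;> rw [e1, e2] <;> simp [add_comm]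
  refine ⟨a, b, u, r, s, t, v, w, GenusTwoSpan.evenSextic (u : K) r s t, ?_, by rwa [mul_one], ?_,
    rfl, GenusTwoSpan.isSmooth_evenSextic h2K hu0 hr0 hs0 ht0 hrs' hrt' hst',
    GenusTwoSpan.isGeometricallyIrreducible_evenSextic h2K hu0 hr0 hrs' hrt',
    GenusTwoSpan.genus_eq_two (GenusTwoSpan.natDegree_evenSextic_le _ _ _ _),
    GenusTwoSpan.exists_morphism_polynomial hD₁ hu0 hv1 hv2 hv3,
    GenusTwoSpan.exists_morphism_laurent hD₂ hu0 hr0 hs0 ht0 ?_ ?_, ?_⟩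
  · rcases hpair with ⟨rfl, rfl⟩ | ⟨rfl, rfl⟩ | ⟨rfl, rfl⟩ | ⟨rfl, rfl⟩ <;> simp
  · rw [GenusTwoSpan.scholtenSextic_eq_evenSextic ha0 hb0 hab0, hu, hr, hs, ht]
  · rw [mul_right_comm, htr, hs, mul_inv_cancel₀ ha0]
  · rw [mul_right_comm, hsr, ht, mul_comm, mul_assoc, inv_mul_cancel₀ hb0, mul_one]
  · have hws : (w : K) ^ 2 = s := by
      rw [hw, hs, hc]
      push_cast
      rw [inv_pow, pow_two]
    refine ⟨(GenusTwoSpan.onCurve_evenSextic_iff _ _ _ _ _).2 ⟨Or.inr (by simp), ?_⟩, ?_⟩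
    · simp [hws]
    · exact Quotient.sound ⟨1, by simp⟩
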